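/- For $k\ge 1$ regard $\mathbb C^k$ as an algebra with the coordinatewise product and unit $e=(1,\dots,1)$; a Banach algebra norm on $\mathbb C^k$ is a submultiplicative norm with $\|e\|=1$, and its ball is $\{v:\|v\|\le 1\}$. For a polynomial $p$ in $n$ variables put $\|p\|_\infty=\sup\{|p(z_1,\dots,z_n)| : |z_i|\le 1\}$. A unital commutative Banach algebra satisfies the multi-variable von Neumann inequality if $\|p(a_1,\dots,a_n)\|\le\|p\|_\infty$ for all $n$, all $a_1,\dots,a_n$ in its unit ball and all polynomials $p$ in $n$ variables. A subset of $\mathbb C^k$ is hyperconvex if it is the ball of a Banach algebra norm on $\mathbb C^k$ that satisfies this inequality; $\mathcal H_k$ is the collection of hyperconvex subsets of $\mathbb C^k$. $\mathcal O_k$ is the collection of balls of Banach algebra norms on $\mathbb C^k$ for which the Banach algebra has a unital isometric representation as an algebra of operators on a Hilbert space. If $E_1,\dots,E_k$ are bounded operators on a Hilbert space with $E_iE_j=\delta_{ij}E_i$ and $\sum_i E_i=I$, then $\mathcal A=\mathrm{span}\{E_1,\dots,E_k\}$ is called a $k$-idempotent operator algebra, and $\mathcal D(\mathcal A)=\{w\in\mathbb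 C^k:\|w_1E_1+\dots+w_kE_k\|\le 1\}$. (1) There are three commuting, diagonalizable contractions $T_1,T_2,T_3$ on the Hilbert space $\mathbb C^4$ and a polynomial $p$ in three variables with $\|p(T_1,T_2,T_3)\|>\|p\|_\infty$. (2) Let $T_1,T_2,T_3,p$ be any such data. Then there is an invertible $4\times4$ matrix $Q$ such that $QT_jQ^{-1}=\mathrm{diag}(w^j_1,\dots,w^j_4)$ for $j=1,2,3$. For every such $Q$, with $E_{ii}$ the canonical diagonal matrix units, the operators $E_i=Q^{-1}E_{ii}Q$ $(i=1,\dots,4)$ satisfy $E_iE_j=\delta_{ij}E_i$ and $\sum_iE_i=I$, so that $\mathcal A=\mathrm{span}\{E_1,\dots,E_4\}$ is a $4$-idempotent operator algebra; $\mathcal D(\mathcal A)\in\mathcal O_4$; the points $w^j=(w^j_1,\dots,w^j_4)$, $j=1,2,3$, lie in $\mathcal D(\mathcal A)$, while $\|p\|_\infty^{-1}\,p(w^1,w^2,w^3)\notin\mathcal D(\mathcal A)$; and $\mathcal D(\mathcal A)$ is not hyperconvex. (3) Consequently $\mathcal H_4\neq\mathcal O_4$, and $\mathcal H_k\subsetneq\mathcal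 O_k$ for all $k\ge 4$. -/

import Mathlib

open scoped Matrix.Norms.L2Operator

/-- The supremum norm of a polynomial in `n` variables over the closed unit polydisk:
`‖p‖ = sup {|p(z₁, …, zₙ)| : |zᵢ| ≤ 1}`. -/
noncomputable def polydiskNorm {n : ℕ} (p : MvPolynomial (Fin n) ℂ) : ℝ :=
  sSup ((fun z : Fin n → ℂ => ‖MvPolynomial.eval z p‖) '' {z | ∀ i, ‖z i‖ ≤ 1})

/-- The value `p(a₁, …, aₙ)` of a polynomial at a tuple of pairwise commuting elements of a
(not necessarily commutative) algebra; the order of the factors is then irrelevant. -/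
noncomputable def evalCommuting {n : ℕ} {R : Type*} [Ring R] [Algebra ℂ R]
    (a : Fin n → R) (p : MvPolynomial (Fin n) ℂ) : R :=
  ∑ m ∈ p.support, p.coeff m • (List.ofFn fun i => a i ^ m i).prod

/-- A Banach algebra norm on `ℂᵏ` (with the coordinatewise product) is an algebra norm with
`‖e‖ = 1` for the unit `e = (1, …, 1)`; completeness is automatic in finite dimension. -/
def IsBanachAlgebraNorm {k : ℕ} (N : AlgebraNorm ℂ (Fin k → ℂ)) : Prop :=
  N 1 = 1

/-- The closed unit ball of a norm on `ℂᵏ`. -/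
def unitBall {k : ℕ} (N : AlgebraNorm ℂ (Fin k → ℂ)) : Set (Fin k → ℂ) :=
  {v | N v ≤ 1}

/-- The multi-variable von Neumann inequality, for polynomials in any number of variables. -/
def SatisfiesMultivariableVonNeumann {A : Type*} [CommRing A] [Algebra ℂ A]
    (N : AlgebraNorm ℂ A) : Prop :=
  ∀ (n : ℕ) (a : Fin n → A), (∀ i, N (a i) ≤ 1) →
    ∀ p : MvPolynomial (Fin n) ℂ, N (MvPolynomial.aeval a p) ≤ polydiskNorm p

/-- A subset of `ℂᵏ` is hyperconvex if it is the unit ball of a Banach algebra norm on `ℂᵏ` that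
satisfies the multi-variable von Neumann inequality. -/
def IsHyperconvex {k : ℕ} (B : Set (Fin k → ℂ)) : Prop :=
  ∃ N : AlgebraNorm ℂ (Fin k → ℂ),
    IsBanachAlgebraNorm N ∧ SatisfiesMultivariableVonNeumann N ∧ B = unitBall N

/-- The collection `𝓗ₖ` of all hyperconvex subsets of `ℂᵏ`. -/
def hyperconvexBalls (k : ℕ) : Set (Set (Fin k → ℂ)) :=
  {B | IsHyperconvex B}

/-- The collection `𝓞ₖ` of the unit balls of those Banach algebra norms on `ℂᵏ` for which the
resulting Banach algebra has a unital isometric representation as an algebra of operators on a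
Hilbert space. -/
def operatorAlgebraBalls (k : ℕ) : Set (Set (Fin k → ℂ)) :=
  {B | ∃ N : AlgebraNorm ℂ (Fin k → ℂ), IsBanachAlgebraNorm N ∧
    (∃ (H : Type) (_ : NormedAddCommGroup H) (_ : InnerProductSpace ℂ H) (_ : CompleteSpace H)
      (π : (Fin k → ℂ) →ₐ[ℂ] (H →L[ℂ] H)), ∀ v, ‖π v‖ = N v) ∧
    B = unitBall N}

/-- Bounded operators `E₁, …, Eₖ` on a Hilbert space with `Eᵢ Eⱼ = δᵢⱼ Eᵢ` and
`E₁ + ⋯ + Eₖ = I`. -/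
structure IsIdempotentSystem {k : ℕ} {H : Type*} [NormedAddCommGroup H] [InnerProductSpace ℂ H]
    [CompleteSpace H] (E : Fin k → H →L[ℂ] H) : Prop where
  mul_eq : ∀ i j, E i * E j = if i = j then E i else 0
  sum_eq : ∑ i, E i = 1

/-- A `k`-idempotent operator algebra is the span of `k` operators as above. -/
def IsIdempotentOperatorAlgebra (k : ℕ) {H : Type*} [NormedAddCommGroup H]
    [InnerProductSpace ℂ H] [CompleteSpace H] (A : Subalgebra ℂ (H →L[ℂ] H)) : Prop :=
  ∃ E : Fin k → H →L[ℂ] H, IsIdempotentSystem E ∧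
    Subalgebra.toSubmodule A = Submodule.span ℂ (Set.range E)

/-- The ball `𝓓(𝓐) = {(w₁, …, wₖ) : ‖w₁ E₁ + ⋯ + wₖ Eₖ‖ ≤ 1}` that the `k`-idempotent operator
algebra `𝓐 = span {E₁, …, Eₖ}` determines in `ℂᵏ`. -/
def idempotentBall {k : ℕ} {H : Type*} [NormedAddCommGroup H] [InnerProductSpace ℂ H]
    (E : Fin k → H →L[ℂ] H) : Set (Fin k → ℂ) :=
  {w | ‖∑ i, w i • E i‖ ≤ 1}

/-- A complex matrix is diagonalizable. -/
def IsDiagonalizable {d : ℕ} (T : Matrix (Fin d) (Fin d) ℂ) : Prop :=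
  ∃ Q : Matrix (Fin d) (Fin d) ℂ, IsUnit Q ∧ ∃ c : Fin d → ℂ, Q * T * Q⁻¹ = Matrix.diagonal c

/-- Three commuting diagonalizable contractions `T₁, T₂, T₃` on the Hilbert space `ℂ⁴` (matrices
carry the operator norm of the Euclidean norm) with `‖p(T₁, T₂, T₃)‖ > ‖p‖_∞`. -/
structure ViolatesVonNeumann (T : Fin 3 → Matrix (Fin 4) (Fin 4) ℂ)
    (p : MvPolynomial (Fin 3) ℂ) : Prop where
  commute : ∀ i j, Commute (T i) (T j)
  diagonalizable : ∀ j, IsDiagonalizable (T j)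
  contraction : ∀ j, ‖T j‖ ≤ 1
  lt_norm : polydiskNorm p < ‖evalCommuting T p‖

/-- The idempotents `Eᵢ = Q⁻¹ Eᵢᵢ Q` (with `Eᵢᵢ` the canonical diagonal matrix units), as operators
on the Hilbert space `ℂᵏ`. -/
noncomputable def conjIdempotent {k : ℕ} (Q : Matrix (Fin k) (Fin k) ℂ) (i : Fin k) :
    EuclideanSpace ℂ (Fin k) →L[ℂ] EuclideanSpace ℂ (Fin k) :=
  Matrix.toEuclideanCLM (n := Fin k) (𝕜 := ℂ) (Q⁻¹ * Matrix.single i i (1 : ℂ) * Q)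

/-! Inclusion (a Cole-type theorem on quotients of function algebras). Let N satisfy the inequality
on A. Take one variable for each element of the unit ball of A: evaluation of polynomials into A is
contractive for the polydisk sup norm, and a rescaled variable lifts each element without increasing
its norm. A functional φ norming v, pulled back to polynomials, is thus dominated by the sup norm,
and `exists_state_dominating` gives a state Λ with |φ(p)|² ≤ Λ(|p|²). On the GNS space of Λ
polynomials act by multiplication; let M and L be the closed subspaces generated from the cyclic
vector by all polynomials and by the kernel of evaluation. Compression to M ⊖ L
(`exists_representation_quotient`) is a contractive representation of A that attains N v. The
Hilbert sum over all v is isometric.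

Strictness. A ball determines its norm, so one faithful representation of ℂ⁴ violating the
inequality suffices; summing it with coordinate characters carries the violation to all k ≥ 4. The
Kaijser–Varopoulos polynomial has polydisk norm at most 5. In the nilpotent algebra ℂ[x, y] / (xy,
x² - y²), with 1, x, y, x² orthonormal, multiplication by ux + vy for a real unit vector (u, v) is a
contraction, and two such elements multiply to their inner product times x². Three unit vectors at
roughly 120° therefore give the polynomial a value near 6 x². Deforming the relation to x² - y² =
1/100 yields the functions on four distinct points, so the multiplications become diagonalizable,
while a factor 99/100 keeps them contractive. -/

open scoped ComplexOrder InnerProductSpace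

/-! ### Polynomials and the sup norm on polydisks -/

/-- The closed unit polydisk with coordinates indexed by `σ`. -/
abbrev Polydisk (σ : Type*) := σ → Metric.closedBall (0 : ℂ) 1

instance (σ : Type*) : CompactSpace (Polydisk σ) :=
  have : CompactSpace (Metric.closedBall (0 : ℂ) 1) :=
    isCompact_iff_compactSpace.mp (isCompact_closedBall _ _)
  inferInstance

/-- Polynomials as continuous functions on the closed polydisk. -/
noncomputable def polydiskFun (σ : Type*) : MvPolynomial σ ℂ →ₐ[ℂ] C(Polydisk σ, ℂ) :=
  MvPolynomial.aeval fun b => ⟨fun x => (x b : ℂ), by fun_prop⟩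

theorem polydiskFun_apply {σ : Type*} (p : MvPolynomial σ ℂ) (x : Polydisk σ) :
    polydiskFun σ p x = MvPolynomial.eval (fun b => (x b : ℂ)) p := by
  induction p using MvPolynomial.induction_on with
  | C a => simp [polydiskFun, Algebra.algebraMap_eq_smul_one]
  | add p q hp hq => simp [hp, hq]
  | mul_X p n hp => simp [hp]; simp [polydiskFun]

theorem bddAbove_polydisk_image {n : ℕ} (p : MvPolynomial (Fin n) ℂ) :
    BddAbove ((fun z : Fin n → ℂ => ‖MvPolynomial.eval z p‖) '' {z | ∀ i, ‖z i‖ ≤ 1}) := by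
  have hc : IsCompact {z : Fin n → ℂ | ∀ i, ‖z i‖ ≤ 1} := by
    have := isCompact_univ_pi (fun _ : Fin n => isCompact_closedBall (0 : ℂ) 1)
    convert this using 1
    ext z; simp [Set.mem_pi]
  exact (hc.image (MvPolynomial.continuous_eval p).norm).bddAbove

theorem norm_eval_le_polydiskNorm {n : ℕ} (p : MvPolynomial (Fin n) ℂ) {z : Fin n → ℂ}
    (hz : ∀ i, ‖z i‖ ≤ 1) : ‖MvPolynomial.eval z p‖ ≤ polydiskNorm p :=
  le_csSup (bddAbove_polydisk_image p) ⟨z, hz, rfl⟩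

theorem polydiskNorm_le {n : ℕ} (p : MvPolynomial (Fin n) ℂ) {c : ℝ}
    (h : ∀ z : Fin n → ℂ, (∀ i, ‖z i‖ ≤ 1) → ‖MvPolynomial.eval z p‖ ≤ c) :
    polydiskNorm p ≤ c := by
  refine csSup_le ⟨_, 0, by simp, rfl⟩ ?_
  rintro _ ⟨z, hz, rfl⟩
  exact h z hz

/-- The von Neumann inequality extends to polynomials in an arbitrary set of variables. -/
theorem SatisfiesMultivariableVonNeumann.aeval_le {A : Type*} [CommRing A] [Algebra ℂ A]
    {N : AlgebraNorm ℂ A} (h : SatisfiesMultivariableVonNeumann N) {σ : Type*} (a : σ → A)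
    (ha : ∀ i, N (a i) ≤ 1) (p : MvPolynomial σ ℂ) :
    N (MvPolynomial.aeval a p) ≤ ‖polydiskFun σ p‖ := by
  obtain ⟨n, f, hf, q, rfl⟩ := p.exists_fin_rename
  rw [MvPolynomial.aeval_rename]
  refine (h n _ (fun i => ha _) q).trans (polydiskNorm_le _ fun z hz => ?_)
  -- Variables that do not occur in the polynomial get the value 0.
  let x : Polydisk σ := Function.extend f (fun i => ⟨z i, by simpa using hz i⟩) 0
  have hx : (fun b => (x b : ℂ)) ∘ f = z := by
    ext i
    simp [x, hf.extend_apply]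
  have := (polydiskFun σ (MvPolynomial.rename f q)).norm_coe_le_norm x
  rwa [polydiskFun_apply, MvPolynomial.eval_rename, hx] at this

/-! ### From dominated functionals to states and GNS representations -/

/-- A linear functional dominated by an algebra norm and attaining it at a given point. -/
theorem AlgebraNorm.exists_dual {A : Type*} [CommRing A] [Algebra ℂ A] (N : AlgebraNorm ℂ A)
    (v : A) : ∃ φ : A →ₗ[ℂ] ℂ, φ v = N v ∧ ∀ a, ‖φ a‖ ≤ N a := by
  let _ : NormedAddCommGroup A := N.toAddGroupNorm.toNormedAddCommGroup
  have hnorm : ∀ a : A, ‖a‖ = N a := fun a => rfl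
  let _ : NormedSpace ℂ A := ⟨fun c a => by rw [hnorm, hnorm, map_smul_eq_mul]⟩
  obtain ⟨g, hg, hv⟩ := exists_dual_vector'' ℂ v
  refine ⟨g, hv, fun a => (g.le_of_opNorm_le hg a).trans_eq (by rw [one_mul, hnorm])⟩

/-- The function `|p|²`. -/
noncomputable def ContinuousMap.absSq {X : Type*} [TopologicalSpace X] (f : C(X, ℂ)) : C(X, ℝ) :=
  ⟨fun x => ‖f x‖ ^ 2, by fun_prop⟩

/-- A linear functional `φ` on a space of functions that is dominated by the supremum norm satisfies
`|φ f|² ≤ Λ (|f|²)` for some positive functional `Λ` of mass one. -/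
theorem exists_state_dominating {X P : Type*} [TopologicalSpace X] [CompactSpace X] [Nonempty X]
    [AddCommGroup P] [Module ℂ P] (ι : P →ₗ[ℂ] C(X, ℂ)) (φ : P →ₗ[ℂ] ℂ)
    (h : ∀ p, ‖φ p‖ ≤ ‖ι p‖) :
    ∃ Λ : C(X, ℝ) →L[ℝ] ℝ, (∀ f, 0 ≤ f → 0 ≤ Λ f) ∧ Λ 1 = 1 ∧
      ∀ p, ‖φ p‖ ^ 2 ≤ Λ (ContinuousMap.absSq (ι p)) := by
  -- The state sought is a normalized functional that is nonnegative on every g p. It separates the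
  -- convex hull of these functions from the open cone of strictly negative functions.
  let g : P → C(X, ℝ) := fun p => (ι p).absSq - ‖φ p‖ ^ 2 • 1
  have hgsmul : ∀ (r : ℝ) p, g ((r : ℂ) • p) = r ^ 2 • g p := by
    intro r p
    ext x
    simp [g, ContinuousMap.absSq, mul_pow, mul_sub]
  let s : Set C(X, ℝ) := {f | Set.MapsTo f Set.univ (Set.Iio 0)}
  have hs : ∀ f, f ∈ s ↔ ∀ x, f x < 0 := fun f => by simp [s, Set.MapsTo]
  have hso : IsOpen s := ContinuousMap.isOpen_setOfPred_mapsTo isCompact_univ isOpen_Iio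
  have hsc : Convex ℝ s := by
    intro f hf f' hf' a b ha hb hab
    rw [hs] at *
    intro x
    have h1 := hf x
    have h2 := hf' x
    simp only [ContinuousMap.add_apply, ContinuousMap.smul_apply, smul_eq_mul]
    rcases ha.eq_or_lt with rfl | ha
    · have : b = 1 := by linarith
      subst this; simpa using h2
    · nlinarith [mul_pos ha (neg_pos.mpr h1), mul_nonneg hb (neg_pos.mpr h2).le]
  have hdisj : Disjoint s (convexHull ℝ (Set.range g)) := by
    rw [Set.disjoint_left]
    intro f hf hf'
    rw [mem_convexHull_iff_exists_fintype] at hf'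
    obtain ⟨J, _, w, z, hw, -, hz, hsum⟩ := hf'
    choose p hp using hz
    rw [hs] at hf
    let S : ℝ := ∑ i, w i * ‖φ (p i)‖ ^ 2
    have hS0 : 0 ≤ S := Finset.sum_nonneg fun i _ => mul_nonneg (hw i) (by positivity)
    -- The weights are chosen so that φ q = S. If the convex combination were negative everywhere,
    -- Cauchy–Schwarz would give |q|² ≤ S · ∑ wᵢ|pᵢ|² < S² pointwise, against |φ q| ≤ ‖q‖.
    let q : P := ∑ i, ((w i : ℂ) * starRingEnd ℂ (φ (p i))) • p i
    have hq : φ q = S := by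
      simp only [q, map_sum, map_smul, smul_eq_mul, S, Complex.ofReal_sum]
      refine Finset.sum_congr rfl fun i _ => ?_
      rw [mul_assoc, mul_comm (starRingEnd ℂ _), Complex.mul_conj, Complex.normSq_eq_norm_sq]
      push_cast; rfl
    have hfx : ∀ x, ∑ i, w i * ‖ι (p i) x‖ ^ 2 < S := by
      intro x
      have := hf x
      rw [← hsum] at this
      simp only [ContinuousMap.sum_apply, ContinuousMap.smul_apply, ← hp, g,
        ContinuousMap.absSq, ContinuousMap.sub_apply, ContinuousMap.coe_mk, ContinuousMap.one_apply,
        smul_eq_mul, mul_one, mul_sub, Finset.sum_sub_distrib] at this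
      linarith
    obtain ⟨x₀⟩ := ‹Nonempty X›
    have hSpos : 0 < S := lt_of_le_of_lt
      (Finset.sum_nonneg fun i _ => mul_nonneg (hw i) (by positivity)) (hfx x₀)
    have hlt : ‖ι q‖ < S := by
      rw [ContinuousMap.norm_lt_iff _ hSpos]
      intro x
      have h1 : ‖ι q x‖ ≤ ∑ i, (Real.sqrt (w i) * ‖φ (p i)‖) * (Real.sqrt (w i) * ‖ι (p i) x‖) := by
        simp only [q, map_sum, map_smul, ContinuousMap.sum_apply, ContinuousMap.smul_apply,
          smul_eq_mul]
        refine (norm_sum_le _ _).trans (Finset.sum_le_sum fun i _ => le_of_eq ?_)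
        rw [norm_mul, norm_mul, RCLike.norm_conj, Complex.norm_real, Real.norm_of_nonneg (hw i)]
        nth_rewrite 1 [← Real.mul_self_sqrt (hw i)]
        ring
      have h2 := Finset.sum_mul_sq_le_sq_mul_sq Finset.univ
        (fun i => Real.sqrt (w i) * ‖φ (p i)‖) (fun i => Real.sqrt (w i) * ‖ι (p i) x‖)
      simp only [mul_pow, Real.sq_sqrt (hw _)] at h2
      have h3 : ‖ι q x‖ ^ 2 ≤ S * ∑ i, w i * ‖ι (p i) x‖ ^ 2 :=
        (pow_le_pow_left₀ (norm_nonneg _) h1 2).trans h2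
      have h4 : ‖ι q x‖ ^ 2 < S ^ 2 := by nlinarith [hfx x]
      exact lt_of_pow_lt_pow_left₀ 2 hS0 h4
    have := h q
    rw [hq, Complex.norm_real, Real.norm_of_nonneg hS0] at this
    linarith
  obtain ⟨F, u, hFs, hFt⟩ := geometric_hahn_banach_open hsc hso (convex_convexHull ℝ _) hdisj
  have hg : ∀ p, u ≤ F (g p) := fun p => hFt _ (subset_convexHull ℝ _ ⟨p, rfl⟩)
  have hu : u ≤ 0 := by
    have := hg 0
    have h0 : g 0 = 0 := by simpa using hgsmul 0 0
    simpa [h0] using this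
  have hneg : ∀ f ∈ s, F f < 0 := fun f hf => (hFs f hf).trans_le hu
  have h1 : 0 < F 1 := by
    have := hneg (-1) (by rw [hs]; simp)
    simpa using this
  have hpos : ∀ f, 0 ≤ f → 0 ≤ F f := by
    intro f hf
    by_contra! hlt
    -- Adding this positive constant makes f strictly positive but only halves the negative value F
    -- f.
    have := hneg (-(f + (-F f / (2 * F 1)) • 1)) (by
      rw [hs]
      intro x
      have hx : 0 ≤ f x := hf x
      have : 0 < -F f / (2 * F 1) := by apply div_pos <;> linarith
      simp
      linarith)
    rw [map_neg, map_add, map_smul, smul_eq_mul] at this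
    have h3 : -F f / (2 * F 1) * F 1 = -F f / 2 := by field_simp
    linarith
  -- The lower bound u improves to 0 because g is homogeneous of degree two: a negative value,
  -- scaled by n², would fall below u.
  have hg0 : ∀ p, 0 ≤ F (g p) := by
    intro p
    by_contra! hlt
    obtain ⟨n, hn⟩ := exists_nat_gt (u / F (g p) + 1)
    have h2 := hg (((n : ℝ) : ℂ) • p)
    rw [hgsmul, map_smul, smul_eq_mul] at h2
    have h3 : u / F (g p) < n := by linarith
    rw [div_lt_iff_of_neg hlt] at h3
    have h5 : (1 : ℝ) ≤ n := by
      have : 0 ≤ u / F (g p) := div_nonneg_of_nonpos hu hlt.le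
      linarith
    nlinarith
  refine ⟨(F 1)⁻¹ • F, fun f hf => ?_, ?_, fun p => ?_⟩
  · exact mul_nonneg (inv_nonneg.mpr h1.le) (hpos f hf)
  · simp [h1.ne']
  · have := hg0 p
    simp only [g, map_sub, map_smul, smul_eq_mul] at this
    rw [smul_apply, smul_eq_mul, ← div_eq_inv_mul, le_div_iff₀ h1]
    linarith

/-- The complex-linear extension of a positive functional on real functions. -/
noncomputable def complexifyFunctional {X : Type*} [TopologicalSpace X] [CompactSpace X]
    (Λ : C(X, ℝ) →L[ℝ] ℝ) (hΛ : ∀ f, 0 ≤ f → 0 ≤ Λ f) : C(X, ℂ) →ₚ[ℂ] ℂ :=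
  let re : C(X, ℂ) → C(X, ℝ) := fun f => ⟨fun x => (f x).re, by fun_prop⟩
  let im : C(X, ℂ) → C(X, ℝ) := fun f => ⟨fun x => (f x).im, by fun_prop⟩
  PositiveLinearMap.mk₀
    { toFun := fun f => Λ (re f) + Λ (im f) * Complex.I
      map_add' := fun f g => by
        have h1 : re (f + g) = re f + re g := by ext; simp [re]
        have h2 : im (f + g) = im f + im g := by ext; simp [im]
        rw [h1, h2, map_add, map_add]; push_cast; ring
      map_smul' := fun c f => by
        have h1 : re (c • f) = c.re • re f - c.im • im f := by ext; simp [re, im]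
        have h2 : im (c • f) = c.re • im f + c.im • re f := by ext; simp [re, im]
        rw [h1, h2, map_sub, map_add, map_smul, map_smul, map_smul, map_smul]
        apply Complex.ext <;> simp }
    (fun f hf => by
      have h2 : im f = 0 := by
        ext x
        exact ((Complex.nonneg_iff.mp (hf x)).2).symm
      have h1 : 0 ≤ re f := fun x => (Complex.nonneg_iff.mp (hf x)).1
      simpa [h2] using hΛ _ h1)

theorem complexifyFunctional_star_mul_self {X : Type*} [TopologicalSpace X] [CompactSpace X]
    (Λ : C(X, ℝ) →L[ℝ] ℝ) (hΛ : ∀ f, 0 ≤ f → 0 ≤ Λ f) (f : C(X, ℂ)) :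
    complexifyFunctional Λ hΛ (star f * f) = Λ f.absSq := by
  have h1 : (⟨fun x => ((star f * f) x).re, by fun_prop⟩ : C(X, ℝ)) = f.absSq := by
    ext x
    simp [ContinuousMap.absSq, ← Complex.normSq_eq_norm_sq, Complex.normSq_apply]
  have h2 : (⟨fun x => ((star f * f) x).im, by fun_prop⟩ : C(X, ℝ)) = 0 := by
    ext x
    simp; ring
  change (Λ _ : ℂ) + Λ _ * Complex.I = _
  beta_reduce
  rw [h1, h2]
  simp

/-- A representation together with a vector dominating a functional that is itself dominated by the
supremum norm. -/
theorem exists_representation_dominating {X : Type} [TopologicalSpace X] [CompactSpace X]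
    [Nonempty X] {P : Type*} [CommRing P] [Algebra ℂ P] (ι : P →ₐ[ℂ] C(X, ℂ)) (φ : P →ₗ[ℂ] ℂ)
    (h : ∀ p, ‖φ p‖ ≤ ‖ι p‖) :
    ∃ (H : Type) (_ : NormedAddCommGroup H) (_ : InnerProductSpace ℂ H) (_ : CompleteSpace H)
      (ρ : P →ₐ[ℂ] (H →L[ℂ] H)) (ξ : H), (∀ p, ‖ρ p‖ ≤ ‖ι p‖) ∧ ‖ξ‖ ≤ 1 ∧
        ∀ p, ‖φ p‖ ≤ ‖ρ p ξ‖ := by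
  obtain ⟨Λ, hΛ, h1, hφ⟩ := exists_state_dominating ι.toLinearMap φ h
  let F := complexifyFunctional Λ hΛ
  let ξ : F.PreGNS := F.toPreGNS 1
  have key : ∀ f : C(X, ℂ), ‖F.gnsStarAlgHom f (ξ : F.GNS)‖ ^ 2 = Λ f.absSq := by
    intro f
    have : F.gnsStarAlgHom f (ξ : F.GNS) = (F.toPreGNS f : F.GNS) := by
      simp [ξ]
    rw [this, UniformSpace.Completion.norm_coe]
    have h3 := F.preGNS_norm_sq (F.toPreGNS f)
    rw [PositiveLinearMap.ofPreGNS_toPreGNS, complexifyFunctional_star_mul_self] at h3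
    exact_mod_cast h3
  refine ⟨F.GNS, inferInstance, inferInstance, inferInstance,
    (F.gnsStarAlgHom : C(X, ℂ) →ₐ[ℂ] (F.GNS →L[ℂ] F.GNS)).comp ι, (ξ : F.GNS),
    fun p => ?_, ?_, fun p => ?_⟩
  · exact NonUnitalStarAlgHom.norm_apply_le F.gnsStarAlgHom (ι p)
  · have h2 := key 1
    rw [map_one, one_apply_eq_self] at h2
    have h3 : (1 : C(X, ℂ)).absSq = 1 := by ext; simp [ContinuousMap.absSq]
    rw [h3, h1] at h2
    exact (sq_le_one_iff₀ (norm_nonneg _)).mp h2.le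
  · exact (sq_le_sq₀ (norm_nonneg _) (norm_nonneg _)).mp ((hφ p).trans (key (ι p)).ge)

/-! ### Compression to semi-invariant subspaces and passage to quotients -/

section Compression

variable {H : Type} [NormedAddCommGroup H] [InnerProductSpace ℂ H]

/-- For closed subspaces `L ≤ M`, a vector of `M` differs from its projection onto `M ⊓ Lᗮ` by an
element of `L`. -/
theorem sub_starProjection_inf_orthogonal_mem {M L : Submodule ℂ H} [L.HasOrthogonalProjection]
    [(M ⊓ Lᗮ).HasOrthogonalProjection] (hLM : L ≤ M) {m : H} (hm : m ∈ M) :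
    m - (M ⊓ Lᗮ).starProjection m ∈ L := by
  have h : (M ⊓ Lᗮ).starProjection m = m - L.starProjection m := by
    refine Submodule.eq_starProjection_of_mem_of_inner_eq_zero
      ⟨M.sub_mem hm (hLM (L.starProjection_apply_mem m)),
        Submodule.sub_starProjection_mem_orthogonal m⟩ fun w hw => ?_
    rw [sub_sub_cancel]
    exact Submodule.inner_right_of_mem_orthogonal (L.starProjection_apply_mem m) hw.2
  rw [h, sub_sub_cancel]
  exact L.starProjection_apply_mem m

theorem starProjection_inf_orthogonal_eq_zero {M L : Submodule ℂ H}
    [(M ⊓ Lᗮ).HasOrthogonalProjection] {l : H} (hl : l ∈ L) :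
    (M ⊓ Lᗮ).starProjection l = 0 := by
  refine Submodule.eq_starProjection_of_mem_of_inner_eq_zero (zero_mem _) fun w hw => ?_
  rw [sub_zero]
  exact Submodule.inner_right_of_mem_orthogonal hl hw.2

variable {P : Type*} [CommRing P] [Algebra ℂ P]

/-- The compression of a representation to the orthogonal difference `M ⊓ Lᗮ` of two closed
invariant subspaces is a representation. -/
noncomputable def compression (ρ : P →ₐ[ℂ] (H →L[ℂ] H)) (M L : Submodule ℂ H)
    [L.HasOrthogonalProjection] [(M ⊓ Lᗮ).HasOrthogonalProjection] (hLM : L ≤ M)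
    (hM : ∀ p, ∀ m ∈ M, ρ p m ∈ M) (hL : ∀ p, ∀ l ∈ L, ρ p l ∈ L) :
    P →ₐ[ℂ] (↥(M ⊓ Lᗮ) →L[ℂ] ↥(M ⊓ Lᗮ)) :=
  let K := M ⊓ Lᗮ
  AlgHom.ofLinearMap
    { toFun := fun p => K.orthogonalProjectionOnto ∘L ρ p ∘L K.subtypeL
      map_add' := fun p q => by ext x; simp
      map_smul' := fun c p => by ext x; simp }
    (by ext x; simp)
    (fun p q => by
      ext x
      have hx := hM q x x.2.1
      -- Multiplicativity: projecting ρ q x changes it by an element of L, which ρ p keeps in L and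
      -- the next projection kills.
      have h1 := hL p _ (sub_starProjection_inf_orthogonal_mem hLM hx)
      have h2 := starProjection_inf_orthogonal_eq_zero (M := M) h1
      rw [map_sub, map_sub, sub_eq_zero] at h2
      simpa [K] using h2)

theorem coe_compression_apply (ρ : P →ₐ[ℂ] (H →L[ℂ] H)) (M L : Submodule ℂ H)
    [L.HasOrthogonalProjection] [(M ⊓ Lᗮ).HasOrthogonalProjection] (hLM : L ≤ M)
    (hM : ∀ p, ∀ m ∈ M, ρ p m ∈ M) (hL : ∀ p, ∀ l ∈ L, ρ p l ∈ L) (p : P) (x : ↥(M ⊓ Lᗮ)) :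
    (compression ρ M L hLM hM hL p x : H) = (M ⊓ Lᗮ).starProjection (ρ p x) := rfl

variable [CompleteSpace H]

/-- Pushing a representation forward along a quotient map `ev`, by compressing it. -/
theorem exists_representation_quotient {A : Type*} [CommRing A] [Algebra ℂ A]
    (ρ : P →ₐ[ℂ] (H →L[ℂ] H)) (ξ : H) (hξ : ‖ξ‖ ≤ 1) (ev : P →ₐ[ℂ] A)
    (hev : Function.Surjective ev) (φ : A →ₗ[ℂ] ℂ) (hφ : ∀ p, ‖φ (ev p)‖ ≤ ‖ρ p ξ‖) :
    ∃ (K : Type) (_ : NormedAddCommGroup K) (_ : InnerProductSpace ℂ K) (_ : CompleteSpace K)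
      (π : A →ₐ[ℂ] (K →L[ℂ] K)), (∀ p, ‖π (ev p)‖ ≤ ‖ρ p‖) ∧ ∀ a, ‖φ a‖ ≤ ‖π a‖ := by
  let orbit : P →ₗ[ℂ] H := (ContinuousLinearMap.apply ℂ H ξ).toLinearMap ∘ₗ ρ.toLinearMap
  have horbit : ∀ p, orbit p = ρ p ξ := fun p => rfl
  let M := (LinearMap.range orbit).topologicalClosure
  let L := ((LinearMap.ker ev.toLinearMap).map orbit).topologicalClosure
  have hLM : L ≤ M := Submodule.topologicalClosure_mono (LinearMap.map_le_range)
  have hmap : ∀ (p : P) (S T : Submodule ℂ H), (∀ s ∈ S, ρ p s ∈ T) →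
      ∀ s ∈ S.topologicalClosure, ρ p s ∈ T.topologicalClosure := fun p S T hST s hs =>
    map_mem_closure (ρ p).continuous hs hST
  have hM : ∀ p, ∀ m ∈ M, ρ p m ∈ M := fun p => hmap p _ _ (by
    rintro _ ⟨q, rfl⟩
    exact ⟨p * q, by simp [horbit]⟩)
  have hL : ∀ p, ∀ l ∈ L, ρ p l ∈ L := fun p => hmap p _ _ (by
    rintro _ ⟨q, hq, rfl⟩
    refine ⟨p * q, ?_, by simp [horbit]⟩
    have hq' : ev q = 0 := hq
    simp [hq'])
  -- The kernel of evaluation is an ideal, so its elements map all of M into L; hence the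
  -- compression factors through A.
  have hML : ∀ p, ev p = 0 → ∀ m ∈ M, ρ p m ∈ L := fun p hp => hmap p _ _ (by
    rintro _ ⟨q, rfl⟩
    exact ⟨p * q, by simp [hp], by simp [horbit]⟩)
  have hLc : IsClosed (L : Set H) := Submodule.isClosed_topologicalClosure _
  have hMc : IsClosed (M : Set H) := Submodule.isClosed_topologicalClosure _
  have : CompleteSpace L := hLc.completeSpace_coe
  have hKc : IsClosed ((M ⊓ Lᗮ : Submodule ℂ H) : Set H) := by
    rw [Submodule.coe_inf]
    exact hMc.inter (Submodule.isClosed_orthogonal L)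
  have : CompleteSpace ↥(M ⊓ Lᗮ) := hKc.completeSpace_coe
  let σ := compression ρ M L hLM hM hL
  have hker : RingHom.ker ev ≤ RingHom.ker σ := by
    intro p hp
    rw [RingHom.mem_ker] at hp ⊢
    ext x
    rw [coe_compression_apply]
    exact starProjection_inf_orthogonal_eq_zero (hML p hp _ x.2.1)
  let π : A →ₐ[ℂ] (↥(M ⊓ Lᗮ) →L[ℂ] ↥(M ⊓ Lᗮ)) :=
    (Ideal.Quotient.liftₐ (RingHom.ker ev) σ hker).comp
      (Ideal.quotientKerAlgEquivOfSurjective hev).symm.toAlgHom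
  have hπ : ∀ p, π (ev p) = σ p := by
    intro p
    have : (Ideal.quotientKerAlgEquivOfSurjective hev).symm (ev p) = Ideal.Quotient.mk _ p := by
      rw [AlgEquiv.symm_apply_eq]
      rfl
    change Ideal.Quotient.liftₐ (RingHom.ker ev) σ hker
      ((Ideal.quotientKerAlgEquivOfSurjective hev).symm (ev p)) = _
    rw [this]
    rfl
  refine ⟨↥(M ⊓ Lᗮ), inferInstance, inferInstance, inferInstance, π, fun p => ?_, fun a => ?_⟩
  · rw [hπ]
    refine ContinuousLinearMap.opNorm_le_bound _ (norm_nonneg _) fun x => ?_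
    rw [Submodule.coe_norm (σ p x), coe_compression_apply]
    refine (Submodule.norm_starProjection_apply_le _ _).trans ?_
    exact (ρ p).le_opNorm x
  · obtain ⟨p, rfl⟩ := hev a
    have hξM : ξ ∈ M := subset_closure ⟨1, by simp [horbit]⟩
    let k : ↥(M ⊓ Lᗮ) := (M ⊓ Lᗮ).orthogonalProjectionOnto ξ
    have hk : (σ p k : H) = (M ⊓ Lᗮ).starProjection (ρ p ξ) := by
      have h1 := hL p _ (sub_starProjection_inf_orthogonal_mem hLM hξM)
      have h2 := starProjection_inf_orthogonal_eq_zero (M := M) h1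
      rw [map_sub, map_sub, sub_eq_zero] at h2
      rw [coe_compression_apply]
      exact h2.symm
    -- φ does not see the kernel of evaluation, so |φ(ev p)| is at most the distance from ρ p ξ to
    -- L, which is the norm of its component in M ⊖ L.
    have hdist : ∀ l ∈ L, ‖φ (ev p)‖ ≤ ‖ρ p ξ - l‖ := by
      have hcl : IsClosed {l : H | ‖φ (ev p)‖ ≤ ‖ρ p ξ - l‖} :=
        isClosed_le continuous_const (by fun_prop)
      intro l hl
      refine closure_minimal ?_ hcl hl
      rintro _ ⟨q, hq, rfl⟩
      have hq' : ev q = 0 := hq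
      have := hφ (p - q)
      simpa [horbit, hq'] using this
    have h3 := hdist _ (sub_starProjection_inf_orthogonal_mem hLM
      (hM p ξ hξM))
    rw [sub_sub_cancel, ← hk, ← Submodule.coe_norm] at h3
    refine h3.trans ?_
    rw [hπ]
    have hk1 : ‖k‖ ≤ 1 := (Submodule.norm_orthogonalProjectionOnto_apply_le _ _).trans hξ
    calc ‖σ p k‖ ≤ ‖σ p‖ * ‖k‖ := (σ p).le_opNorm k
      _ ≤ ‖σ p‖ * 1 := by gcongr
      _ = ‖σ p‖ := mul_one _

end Compression

/-- A norm satisfying the multi-variable von Neumann inequality is attained, at any given point, by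
a contractive Hilbert space representation. -/
theorem SatisfiesMultivariableVonNeumann.exists_representation {A : Type} [CommRing A]
    [Algebra ℂ A] {N : AlgebraNorm ℂ A} (h : SatisfiesMultivariableVonNeumann N) (v : A) :
    ∃ (K : Type) (_ : NormedAddCommGroup K) (_ : InnerProductSpace ℂ K) (_ : CompleteSpace K)
      (π : A →ₐ[ℂ] (K →L[ℂ] K)), (∀ a, ‖π a‖ ≤ N a) ∧ N v ≤ ‖π v‖ := by
  let σ := {a : A // N a ≤ 1}
  let ev : MvPolynomial σ ℂ →ₐ[ℂ] A := MvPolynomial.aeval Subtype.val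
  have hN : ∀ p, N (ev p) ≤ ‖polydiskFun σ p‖ := h.aeval_le _ fun i => i.2
  have hlift : ∀ a : A, ∃ p, ev p = a ∧ ‖polydiskFun σ p‖ ≤ N a := by
    intro a
    rcases eq_or_ne a 0 with rfl | ha
    · exact ⟨0, by simp⟩
    have hNa : 0 < N a := lt_of_le_of_ne (apply_nonneg N a)
      fun h0 => ha (eq_zero_of_map_eq_zero N h0.symm)
    have hu : N (((N a : ℂ)⁻¹) • a) ≤ 1 := by
      rw [map_smul_eq_mul, norm_inv, Complex.norm_real, Real.norm_of_nonneg hNa.le,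
        inv_mul_cancel₀ hNa.ne']
    -- The lift is N a times the variable attached to a / N a; its sup norm is at most N a.
    refine ⟨(N a : ℂ) • MvPolynomial.X ⟨_, hu⟩, ?_, ?_⟩
    · rw [map_smul, MvPolynomial.aeval_X, smul_smul,
        mul_inv_cancel₀ (Complex.ofReal_ne_zero.mpr hNa.ne'), one_smul]
    · rw [ContinuousMap.norm_le _ hNa.le]
      intro x
      rw [polydiskFun_apply, MvPolynomial.smul_eval, MvPolynomial.eval_X, norm_mul,
        Complex.norm_real, Real.norm_of_nonneg hNa.le]
      have := (x ⟨_, hu⟩).2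
      rw [mem_closedBall_zero_iff] at this
      exact mul_le_of_le_one_right hNa.le this
  have hev : Function.Surjective ev := fun a => (hlift a).imp fun _ hp => hp.1
  obtain ⟨φ, hφv, hφ⟩ := N.exists_dual v
  obtain ⟨H, _, _, _, ρ, ξ, hρ, hξ, hφξ⟩ := exists_representation_dominating (polydiskFun σ)
    (φ ∘ₗ ev.toLinearMap) fun p => (hφ _).trans (hN p)
  obtain ⟨K, i1, i2, i3, π, hπ, hπφ⟩ := exists_representation_quotient ρ ξ hξ ev hev φ hφξ
  refine ⟨K, i1, i2, i3, π, fun a => ?_, ?_⟩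
  · obtain ⟨p, rfl, hp⟩ := hlift a
    exact ((hπ p).trans (hρ p)).trans hp
  · have := hπφ v
    rwa [hφv, Complex.norm_real, Real.norm_of_nonneg (apply_nonneg N v)] at this

/-! ### Hilbert sums of representations -/

section DirectSum

variable {J : Type} {H : J → Type} [∀ j, NormedAddCommGroup (H j)]

theorem lp_two_norm_sq (f : lp H 2) : HasSum (fun j => ‖f j‖ ^ 2) (‖f‖ ^ 2) := by
  have := lp.hasSum_norm (by norm_num : 0 < (2 : ENNReal).toReal) f
  simpa using this

variable [∀ j, InnerProductSpace ℂ (H j)]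

/-- The diagonal operator on a Hilbert sum given by a bounded family of operators. -/
theorem exists_lp_diagonal (T : ∀ j, H j →L[ℂ] H j) (C : ℝ) (hC : 0 ≤ C) (hT : ∀ j, ‖T j‖ ≤ C) :
    ∃ S : lp H 2 →L[ℂ] lp H 2, ‖S‖ ≤ C ∧ ∀ f j, S f j = T j (f j) := by
  have hle : ∀ (f : lp H 2) j, ‖T j (f j)‖ ^ 2 ≤ C ^ 2 * ‖f j‖ ^ 2 := by
    intro f j
    rw [← mul_pow]
    exact pow_le_pow_left₀ (norm_nonneg _) ((T j).le_of_opNorm_le (hT j) _) 2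
  have hmem : ∀ f : lp H 2, Memℓp (fun j => T j (f j)) 2 := by
    intro f
    apply memℓp_gen
    have := Summable.of_nonneg_of_le (fun j => by positivity) (hle f)
      ((lp_two_norm_sq f).summable.mul_left _)
    simpa using this
  let S : lp H 2 →ₗ[ℂ] lp H 2 :=
    { toFun := fun f => ⟨_, hmem f⟩
      map_add' := fun f g => by ext j; exact map_add (T j) _ _
      map_smul' := fun c f => by ext j; exact map_smul (T j) _ _ }
  refine ⟨S.mkContinuous C fun f => ?_, S.mkContinuous_norm_le hC _, fun f j => rfl⟩
  rw [← sq_le_sq₀ (norm_nonneg _) (by positivity), mul_pow]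
  exact hasSum_le (hle f) (lp_two_norm_sq (S f)) ((lp_two_norm_sq f).mul_left _)

/-- The Hilbert sum of a bounded family of representations. -/
theorem exists_directSum_representation {A : Type*} [Ring A] [Algebra ℂ A]
    [∀ j, CompleteSpace (H j)] (π : ∀ j, A →ₐ[ℂ] (H j →L[ℂ] H j))
    (hπ : ∀ a, ∃ C, ∀ j, ‖π j a‖ ≤ C) :
    ∃ σ : A →ₐ[ℂ] (lp H 2 →L[ℂ] lp H 2),
      (∀ a C, 0 ≤ C → (∀ j, ‖π j a‖ ≤ C) → ‖σ a‖ ≤ C) ∧ ∀ a j, ‖π j a‖ ≤ ‖σ a‖ := by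
  classical
  have key : ∀ a, ∃ S : lp H 2 →L[ℂ] lp H 2, ∀ f j, S f j = π j a (f j) := by
    intro a
    obtain ⟨C, hC⟩ := hπ a
    obtain ⟨S, -, hS⟩ := exists_lp_diagonal (fun j => π j a) (max C 0) (le_max_right _ _)
      fun j => (hC j).trans (le_max_left _ _)
    exact ⟨S, hS⟩
  choose S hS using key
  let σ : A →ₐ[ℂ] (lp H 2 →L[ℂ] lp H 2) := AlgHom.ofLinearMap
    { toFun := S
      map_add' := fun a b => by ext f j; simp [hS]
      map_smul' := fun c a => by ext f j; simp [hS] }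
    (by ext f j; simp [hS])
    (fun a b => by ext f j; simp [hS])
  refine ⟨σ, fun a C hC h => ?_, fun a j => ?_⟩
  · obtain ⟨S', hS', h'⟩ := exists_lp_diagonal (fun j => π j a) C hC h
    have : σ a = S' := by ext f j; rw [h']; exact hS a f j
    rwa [this]
  · refine ContinuousLinearMap.opNorm_le_bound _ (norm_nonneg _) fun x => ?_
    have h1 : π j a x = σ a (lp.single 2 j x) j := by
      rw [show σ a (lp.single 2 j x) j = π j a (lp.single 2 j x j) from hS _ _ _,
        lp.single_apply_self]
    calc ‖π j a x‖ ≤ ‖σ a (lp.single 2 j x)‖ := by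
          rw [h1]; exact lp.norm_apply_le_norm (by norm_num) _ _
      _ ≤ ‖σ a‖ * ‖lp.single 2 j x‖ := (σ a).le_opNorm _
      _ = ‖σ a‖ * ‖x‖ := by rw [lp.norm_single (by norm_num)]

end DirectSum

/-- A commutative Banach algebra satisfying the multi-variable von Neumann inequality is an
operator algebra. -/
theorem SatisfiesMultivariableVonNeumann.exists_isometric_representation {A : Type} [CommRing A]
    [Algebra ℂ A] {N : AlgebraNorm ℂ A} (h : SatisfiesMultivariableVonNeumann N) :
    ∃ (H : Type) (_ : NormedAddCommGroup H) (_ : InnerProductSpace ℂ H) (_ : CompleteSpace H)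
      (π : A →ₐ[ℂ] (H →L[ℂ] H)), ∀ a, ‖π a‖ = N a := by
  choose K i1 i2 i3 π hπ hv using fun v => h.exists_representation v
  obtain ⟨σ, hσ, hσ'⟩ := exists_directSum_representation π fun a => ⟨N a, fun v => hπ v a⟩
  refine ⟨lp K 2, inferInstance, inferInstance, inferInstance, σ, fun a => le_antisymm ?_ ?_⟩
  · exact hσ a _ (apply_nonneg N a) fun v => hπ v a
  · exact (hv a).trans (hσ' a a)

theorem hyperconvexBalls_subset_operatorAlgebraBalls (k : ℕ) :
    hyperconvexBalls k ⊆ operatorAlgebraBalls k := by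
  rintro B ⟨N, hN, hvN, rfl⟩
  exact ⟨N, hN, hvN.exists_isometric_representation, rfl⟩

/-! ### Balls of representations and failure of hyperconvexity -/

/-- The algebra norm induced by a faithful representation. -/
def AlgebraNorm.ofRepresentation {A B : Type*} [Ring A] [Algebra ℂ A] [NormedRing B]
    [NormedAlgebra ℂ B] (π : A →ₐ[ℂ] B) (hπ : Function.Injective π) : AlgebraNorm ℂ A where
  toFun a := ‖π a‖
  map_zero' := by simp
  add_le' a b := by rw [map_add]; exact norm_add_le _ _
  neg' a := by rw [map_neg, norm_neg]
  mul_le' a b := by rw [map_mul]; exact norm_mul_le _ _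
  smul' c a := by rw [map_smul, norm_smul]
  eq_zero_of_map_eq_zero' a ha := by
    rw [norm_eq_zero, ← map_zero π] at ha
    exact hπ ha

/-- The ball of a faithful unital representation belongs to `𝓞ₖ`. -/
theorem ball_mem_operatorAlgebraBalls {k : ℕ} (hk : k ≠ 0) {H : Type} [NormedAddCommGroup H]
    [InnerProductSpace ℂ H] [CompleteSpace H] (π : (Fin k → ℂ) →ₐ[ℂ] (H →L[ℂ] H))
    (hπ : Function.Injective π) : {v | ‖π v‖ ≤ 1} ∈ operatorAlgebraBalls k := by
  refine ⟨AlgebraNorm.ofRepresentation π hπ, ?_, ⟨H, _, _, ‹_›, π, fun v => rfl⟩, rfl⟩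
  have : NeZero k := ⟨hk⟩
  have : Nontrivial (H →L[ℂ] H) := hπ.nontrivial
  have : Nontrivial H := by
    by_contra hH
    rw [not_nontrivial_iff_subsingleton] at hH
    exact not_subsingleton (H →L[ℂ] H) inferInstance
  change ‖π 1‖ = 1
  rw [map_one, norm_one]

/-- The coordinates are dominated by the norm of any faithful representation of `ℂᵏ`. -/
theorem norm_apply_le_norm_representation {k : ℕ} {B : Type*} [NormedRing B] [NormedAlgebra ℂ B]
    (π : (Fin k → ℂ) →ₐ[ℂ] B) (hπ : Function.Injective π) (v : Fin k → ℂ) (i : Fin k) :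
    ‖v i‖ ≤ ‖π v‖ := by
  have h1 : v * Pi.single i 1 = v i • Pi.single i 1 := by
    ext j
    by_cases h : j = i
    · subst h; simp
    · simp [h]
  have h2 : 0 < ‖π (Pi.single i 1)‖ := by
    rw [norm_pos_iff, Ne, map_eq_zero_iff π hπ]
    simp
  have h3 := norm_mul_le (π v) (π (Pi.single i 1))
  rw [← map_mul, h1, map_smul, norm_smul] at h3
  exact le_of_mul_le_mul_right h3 h2

/-- A homogeneous function bounded by one on the unit ball is dominated by the norm. -/
theorem AlgebraNorm.le_of_unitBall_subset {A : Type*} [CommRing A] [Algebra ℂ A]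
    (N : AlgebraNorm ℂ A) {M : A → ℝ} (hM : ∀ (c : ℂ) a, M (c • a) = ‖c‖ * M a)
    (h : ∀ a, N a ≤ 1 → M a ≤ 1) (a : A) : M a ≤ N a := by
  -- Dividing by N a + ε avoids the case N a = 0.
  refine le_of_forall_pos_le_add fun ε hε => ?_
  have hpos : 0 < N a + ε := by linarith [apply_nonneg N a]
  have hc : ‖((N a + ε : ℝ) : ℂ)⁻¹‖ = (N a + ε)⁻¹ := by
    rw [norm_inv, Complex.norm_real, Real.norm_of_nonneg hpos.le]
  have h1 : M ((((N a + ε : ℝ) : ℂ)⁻¹) • a) ≤ 1 := by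
    apply h
    rw [map_smul_eq_mul, hc, inv_mul_le_iff₀ hpos]
    linarith
  rw [hM, hc, inv_mul_le_iff₀ hpos] at h1
  linarith

/-- A representation violating the von Neumann inequality has a ball that is not hyperconvex. -/
theorem not_isHyperconvex_ball {k n : ℕ} {B : Type*} [NormedRing B] [NormedAlgebra ℂ B]
    (π : (Fin k → ℂ) →ₐ[ℂ] B) (a : Fin n → Fin k → ℂ) (ha : ∀ i, ‖π (a i)‖ ≤ 1)
    (p : MvPolynomial (Fin n) ℂ) (hp : polydiskNorm p < ‖π (MvPolynomial.aeval a p)‖) :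
    ¬ IsHyperconvex {v | ‖π v‖ ≤ 1} := by
  rintro ⟨N, -, hvN, hball⟩
  have h : ∀ v, ‖π v‖ ≤ 1 ↔ N v ≤ 1 := fun v => Set.ext_iff.mp hball v
  have h1 := N.le_of_unitBall_subset (M := fun v => ‖π v‖) (fun c a => by rw [map_smul, norm_smul])
    (fun v => (h v).mpr) (MvPolynomial.aeval a p)
  have h2 := hvN n a (fun i => (h _).mp (ha i)) p
  linarith

/-- A violation of the von Neumann inequality on `ℂᵐ` persists on `ℂᵏ` for `k ≥ m`. -/
theorem exists_operatorAlgebraBall_not_isHyperconvex {m k n : ℕ} (hmk : m ≤ k) (hk : k ≠ 0)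
    {H : Type} [NormedAddCommGroup H] [InnerProductSpace ℂ H] [CompleteSpace H]
    (π : (Fin m → ℂ) →ₐ[ℂ] (H →L[ℂ] H)) (hπ : Function.Injective π) (a : Fin n → Fin m → ℂ)
    (ha : ∀ i, ‖π (a i)‖ ≤ 1) (p : MvPolynomial (Fin n) ℂ)
    (hp : polydiskNorm p < ‖π (MvPolynomial.aeval a p)‖) :
    ∃ B ∈ operatorAlgebraBalls k, ¬ IsHyperconvex B := by
  let restr : (Fin k → ℂ) →ₐ[ℂ] (Fin m → ℂ) :=
    AlgHom.pi fun i => Pi.evalAlgHom ℂ (fun _ => ℂ) (Fin.castLE hmk i)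
  have hrestr : ∀ v i, restr v i = v (Fin.castLE hmk i) := fun v i => rfl
  have hfam : ∀ o : Option (Fin k), ∃ (F : Type) (_ : NormedAddCommGroup F)
      (_ : InnerProductSpace ℂ F) (_ : CompleteSpace F) (τ : (Fin k → ℂ) →ₐ[ℂ] (F →L[ℂ] F)),
      ∀ v, ‖τ v‖ = o.elim ‖π (restr v)‖ fun i => ‖v i‖ := by
    rintro (_ | i)
    · exact ⟨H, _, _, ‹_›, π.comp restr, fun v => rfl⟩
    · exact ⟨ℂ, _, _, inferInstance,
        (Algebra.ofId ℂ (ℂ →L[ℂ] ℂ)).comp (Pi.evalAlgHom ℂ (fun _ => ℂ) i),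
        fun v => norm_algebraMap' (ℂ →L[ℂ] ℂ) (v i)⟩
  choose F i1 i2 i3 τ hτ using hfam
  have hnone : ∀ v, ‖τ none v‖ = ‖π (restr v)‖ := hτ none
  have hsome : ∀ i v, ‖τ (some i) v‖ = ‖v i‖ := fun i => hτ (some i)
  obtain ⟨σ, hσ, hσ'⟩ := exists_directSum_representation τ fun v =>
    ⟨∑ o, ‖τ o v‖, fun o => Finset.single_le_sum (f := fun o => ‖τ o v‖)
      (fun _ _ => norm_nonneg _) (Finset.mem_univ o)⟩
  -- The characters make the sum faithful, even though π ∘ restr ignores the coordinates beyond m.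
  have hσi : Function.Injective σ := by
    rw [injective_iff_map_eq_zero]
    intro v hv
    ext i
    have := hσ' v (some i)
    rw [hsome, hv, norm_zero] at this
    simpa using this
  -- Extension by zero stays in the ball, since the coordinates of a j are bounded by ‖π (a j)‖ ≤ 1.
  let b : Fin n → Fin k → ℂ := fun j i => if h : (i : ℕ) < m then a j ⟨i, h⟩ else 0
  have hb : ∀ j, restr (b j) = a j := by
    intro j
    ext i
    simp [hrestr, b]
  refine ⟨_, ball_mem_operatorAlgebraBalls hk σ hσi,
    not_isHyperconvex_ball σ b (fun j => hσ _ _ zero_le_one fun o => ?_) p ?_⟩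
  · match o with
    | none => rw [hnone, hb]; exact ha j
    | some i =>
      rw [hsome]
      by_cases h : (i : ℕ) < m
      · simp only [b, h, dite_true]
        exact (norm_apply_le_norm_representation π hπ _ _).trans (ha j)
      · simp [b, h]
  · refine hp.trans_le ?_
    have h1 := hσ' (MvPolynomial.aeval b p) none
    rw [hnone] at h1
    have h2 : restr (MvPolynomial.aeval b p) = MvPolynomial.aeval a p := by
      rw [MvPolynomial.comp_aeval_apply]
      simp only [hb]
    rwa [h2] at h1

/-! ### Evaluation at commuting tuples and conjugated diagonal matrices -/

theorem evalCommuting_map {n : ℕ} {A R : Type*} [CommRing A] [Algebra ℂ A] [Ring R] [Algebra ℂ R]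
    (c : A →ₐ[ℂ] R) (a : Fin n → A) (p : MvPolynomial (Fin n) ℂ) :
    evalCommuting (fun i => c (a i)) p = c (MvPolynomial.aeval a p) := by
  rw [MvPolynomial.aeval_def, MvPolynomial.eval₂_eq', map_sum, evalCommuting]
  refine Finset.sum_congr rfl fun m _ => ?_
  rw [← Algebra.smul_def, map_smul, ← List.prod_ofFn, map_list_prod, List.map_ofFn]
  simp [Function.comp_def]

/-- The representation `v ↦ Q⁻¹ diag(v) Q` of `ℂᵏ` by matrices. -/
noncomputable def conjDiagonal {k : ℕ} (Q : Matrix (Fin k) (Fin k) ℂ) (hQ : IsUnit Q) :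
    (Fin k → ℂ) →ₐ[ℂ] Matrix (Fin k) (Fin k) ℂ :=
  AlgHom.ofLinearMap
    { toFun := fun v => Q⁻¹ * Matrix.diagonal v * Q
      map_add' := fun v w => by
        rw [show Matrix.diagonal (v + w) = _ from (Matrix.diagonal_add v w).symm, Matrix.mul_add,
          Matrix.add_mul]
      map_smul' := fun c v => by
        rw [Matrix.diagonal_smul, Matrix.mul_smul, Matrix.smul_mul, RingHom.id_apply] }
    (by
      change Q⁻¹ * Matrix.diagonal 1 * Q = 1
      rw [show Matrix.diagonal 1 = 1 from Matrix.diagonal_one, Matrix.mul_one,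
        Matrix.nonsing_inv_mul _
        ((Matrix.isUnit_iff_isUnit_det Q).mp hQ)])
    (fun v w => by
      change Q⁻¹ * Matrix.diagonal (v * w) * Q =
        (Q⁻¹ * Matrix.diagonal v * Q) * (Q⁻¹ * Matrix.diagonal w * Q)
      have h := Matrix.mul_nonsing_inv _ ((Matrix.isUnit_iff_isUnit_det Q).mp hQ)
      calc Q⁻¹ * Matrix.diagonal (v * w) * Q
          = Q⁻¹ * Matrix.diagonal v * (Matrix.diagonal w) * Q := by
            rw [Matrix.mul_assoc Q⁻¹ (Matrix.diagonal v), Matrix.diagonal_mul_diagonal]; rfl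
        _ = Q⁻¹ * Matrix.diagonal v * (Q * Q⁻¹) * Matrix.diagonal w * Q := by
            rw [h, Matrix.mul_one]
        _ = _ := by simp only [Matrix.mul_assoc])

section ConjDiagonal

variable {k : ℕ} {Q : Matrix (Fin k) (Fin k) ℂ}

theorem conjDiagonal_apply (hQ : IsUnit Q) (v : Fin k → ℂ) :
    conjDiagonal Q hQ v = Q⁻¹ * Matrix.diagonal v * Q := rfl

theorem mul_conjDiagonal_mul_inv (hQ : IsUnit Q) (v : Fin k → ℂ) :
    Q * conjDiagonal Q hQ v * Q⁻¹ = Matrix.diagonal v := by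
  have h := Matrix.mul_nonsing_inv _ ((Matrix.isUnit_iff_isUnit_det Q).mp hQ)
  rw [conjDiagonal_apply]
  calc Q * (Q⁻¹ * Matrix.diagonal v * Q) * Q⁻¹ = (Q * Q⁻¹) * Matrix.diagonal v * (Q * Q⁻¹) := by
        simp only [Matrix.mul_assoc]
    _ = Matrix.diagonal v := by rw [h, Matrix.mul_one, Matrix.one_mul]

theorem eq_conjDiagonal (hQ : IsUnit Q) {T : Matrix (Fin k) (Fin k) ℂ} {v : Fin k → ℂ}
    (h : Q * T * Q⁻¹ = Matrix.diagonal v) : T = conjDiagonal Q hQ v := by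
  have h1 := Matrix.nonsing_inv_mul _ ((Matrix.isUnit_iff_isUnit_det Q).mp hQ)
  rw [conjDiagonal_apply, ← h]
  calc T = (Q⁻¹ * Q) * T * (Q⁻¹ * Q) := by rw [h1, Matrix.mul_one, Matrix.one_mul]
    _ = _ := by simp only [Matrix.mul_assoc]

theorem conjDiagonal_injective (hQ : IsUnit Q) : Function.Injective (conjDiagonal Q hQ) := by
  intro v w h
  have := congrArg (fun M => Q * M * Q⁻¹) h
  simp only [mul_conjDiagonal_mul_inv] at this
  exact Matrix.diagonal_injective this

/-- The representation `v ↦ Q⁻¹ diag(v) Q` of `ℂᵏ` by operators. -/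
noncomputable def conjRepresentation {k : ℕ} (Q : Matrix (Fin k) (Fin k) ℂ) (hQ : IsUnit Q) :
    (Fin k → ℂ) →ₐ[ℂ] (EuclideanSpace ℂ (Fin k) →L[ℂ] EuclideanSpace ℂ (Fin k)) :=
  (Matrix.toEuclideanCLM (n := Fin k) (𝕜 := ℂ) : Matrix (Fin k) (Fin k) ℂ →ₐ[ℂ] _).comp
    (conjDiagonal Q hQ)

theorem norm_conjRepresentation (hQ : IsUnit Q) (v : Fin k → ℂ) :
    ‖conjRepresentation Q hQ v‖ = ‖conjDiagonal Q hQ v‖ := rfl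

theorem conjRepresentation_injective (hQ : IsUnit Q) :
    Function.Injective (conjRepresentation Q hQ) :=
  (Matrix.toEuclideanCLM (n := Fin k) (𝕜 := ℂ)).injective.comp (conjDiagonal_injective hQ)

theorem conjRepresentation_single (hQ : IsUnit Q) (i : Fin k) :
    conjRepresentation Q hQ (Pi.single i 1) = conjIdempotent Q i := by
  rw [conjIdempotent, ← Matrix.diagonal_single]
  rfl

theorem conjRepresentation_eq_sum (hQ : IsUnit Q) (v : Fin k → ℂ) :
    conjRepresentation Q hQ v = ∑ i, v i • conjIdempotent Q i := by
  conv_lhs => rw [pi_eq_sum_univ' v]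
  rw [map_sum]
  refine Finset.sum_congr rfl fun i _ => ?_
  rw [← conjRepresentation_single hQ, ← map_smul]

theorem idempotentBall_conjIdempotent (hQ : IsUnit Q) :
    idempotentBall (conjIdempotent Q) = {v | ‖conjRepresentation Q hQ v‖ ≤ 1} := by
  ext v
  rw [Set.mem_ofPred_eq, conjRepresentation_eq_sum]
  rfl

theorem isIdempotentSystem_conjIdempotent (hQ : IsUnit Q) :
    IsIdempotentSystem (conjIdempotent Q) where
  mul_eq i j := by
    simp only [← conjRepresentation_single hQ]
    rw [← map_mul]
    split_ifs with h
    · subst h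
      congr 1
      ext j
      by_cases h : j = i <;> simp [h]
    · rw [← map_zero (conjRepresentation Q hQ)]
      congr 1
      ext l
      by_cases h1 : l = i
      · subst h1; simp [h]
      · simp [h1]
  sum_eq := by
    rw [← map_one (conjRepresentation Q hQ), conjRepresentation_eq_sum]
    simp

theorem exists_subalgebra_span_conjIdempotent (hQ : IsUnit Q) :
    ∃ A : Subalgebra ℂ (EuclideanSpace ℂ (Fin k) →L[ℂ] EuclideanSpace ℂ (Fin k)),
      Subalgebra.toSubmodule A = Submodule.span ℂ (Set.range (conjIdempotent Q)) ∧
        IsIdempotentOperatorAlgebra k A := by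
  have h : Subalgebra.toSubmodule (conjRepresentation Q hQ).range =
      Submodule.span ℂ (Set.range (conjIdempotent Q)) := by
    apply le_antisymm
    · rintro _ ⟨v, rfl⟩
      change conjRepresentation Q hQ v ∈ _
      rw [conjRepresentation_eq_sum]
      exact Submodule.sum_mem _ fun i _ =>
        Submodule.smul_mem _ _ (Submodule.subset_span ⟨i, rfl⟩)
    · rw [Submodule.span_le]
      rintro _ ⟨i, rfl⟩
      exact ⟨Pi.single i 1, conjRepresentation_single hQ i⟩
  exact ⟨_, h, _, isIdempotentSystem_conjIdempotent hQ, h⟩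

end ConjDiagonal

/-! ### Definiteness of the polydisk norm; simultaneous diagonalization -/

theorem eq_zero_of_polydiskNorm_eq_zero {n : ℕ} {p : MvPolynomial (Fin n) ℂ}
    (h : polydiskNorm p = 0) : p = 0 := by
  refine MvPolynomial.funext_set (fun _ => Metric.closedBall (0 : ℂ) 1) (fun _ => ?_) fun z hz => ?_
  · exact infinite_of_mem_nhds (0 : ℂ) (Metric.closedBall_mem_nhds _ one_pos)
  · rw [map_zero, ← norm_le_zero_iff, ← h]
    exact norm_eval_le_polydiskNorm p fun i => by simpa using hz i (Set.mem_univ i)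

theorem polydiskNorm_nonneg {n : ℕ} (p : MvPolynomial (Fin n) ℂ) : 0 ≤ polydiskNorm p :=
  (norm_nonneg _).trans (norm_eval_le_polydiskNorm p (z := 0) (by simp))

/-- Conjugation by Q turns T - μ into diag(cᵢ - μ), whose powers kill no more than itself; the
columns of Q⁻¹ are eigenvectors and span. Thus the joint generalized eigenspaces of a commuting
family consist of common eigenvectors. -/
theorem maxGenEigenspace_of_isDiagonalizable {d : ℕ} {T : Matrix (Fin d) (Fin d) ℂ}
    (hT : IsDiagonalizable T) :
    (∀ μ, Module.End.maxGenEigenspace (Matrix.toLin' T) μ =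
        Module.End.eigenspace (Matrix.toLin' T) μ) ∧
      ⨆ μ, Module.End.maxGenEigenspace (Matrix.toLin' T) μ = ⊤ := by
  obtain ⟨Q, hQ, c, hc⟩ := hT
  have hdet := (Matrix.isUnit_iff_isUnit_det Q).mp hQ
  have h1 : Q * T = Matrix.diagonal c * Q := by
    rw [← hc, Matrix.mul_assoc (Q * T), Matrix.nonsing_inv_mul _ hdet, Matrix.mul_one]
  have h2 : T * Q⁻¹ = Q⁻¹ * Matrix.diagonal c := by
    rw [← hc, Matrix.mul_assoc Q, ← Matrix.mul_assoc Q⁻¹, Matrix.nonsing_inv_mul _ hdet,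
      Matrix.one_mul]
  have happ : ∀ v i, (Q.mulVec (T.mulVec v)) i = c i * (Q.mulVec v) i := by
    intro v i
    rw [Matrix.mulVec_mulVec, h1, ← Matrix.mulVec_mulVec, Matrix.mulVec_diagonal]
  have heig : ∀ μ, Module.End.maxGenEigenspace (Matrix.toLin' T) μ =
      Module.End.eigenspace (Matrix.toLin' T) μ := by
    intro μ
    apply le_antisymm
    · intro v hv
      rw [Module.End.mem_maxGenEigenspace] at hv
      obtain ⟨m, hm⟩ := hv
      have hpow : ∀ (m : ℕ) i, (Q.mulVec (((Matrix.toLin' T - μ • 1) ^ m) v)) i =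
          (c i - μ) ^ m * (Q.mulVec v) i := by
        intro m i
        induction m with
        | zero => simp
        | succ m ih =>
          rw [pow_succ', Module.End.mul_apply, LinearMap.sub_apply, Matrix.mulVec_sub,
            Matrix.toLin'_apply, Pi.sub_apply, happ, LinearMap.smul_apply, Module.End.one_apply,
            Matrix.mulVec_smul, Pi.smul_apply, ih, smul_eq_mul]
          ring
      rw [Module.End.mem_eigenspace_iff, Matrix.toLin'_apply]
      have hinj : Function.Injective Q.mulVec := Matrix.mulVec_injective_of_isUnit hQ
      apply hinj
      ext i
      rw [happ, Matrix.mulVec_smul, Pi.smul_apply, smul_eq_mul]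
      have := hpow m i
      rw [hm, Matrix.mulVec_zero, Pi.zero_apply, eq_comm, mul_eq_zero] at this
      rcases this with h | h
      · rw [sub_eq_zero.mp (eq_zero_of_pow_eq_zero h)]
      · rw [h, mul_zero, mul_zero]
    · exact Module.End.eigenspace_le_maxGenEigenspace
  refine ⟨heig, ?_⟩
  rw [eq_top_iff]
  intro v _
  have hv : v = ∑ i, (Q.mulVec v) i • (Q⁻¹).col i := by
    have h3 : v = Q⁻¹.mulVec (Q.mulVec v) := by
      rw [Matrix.mulVec_mulVec, Matrix.nonsing_inv_mul _ hdet, Matrix.one_mulVec]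
    conv_lhs => rw [h3, Matrix.mulVec_eq_sum]
    simp only [op_smul_eq_smul]
    rfl
  rw [hv]
  refine Submodule.sum_mem _ fun i _ => Submodule.smul_mem _ _ ?_
  refine Submodule.mem_iSup_of_mem (c i) ?_
  rw [heig, Module.End.mem_eigenspace_iff, Matrix.toLin'_apply]
  ext j
  have := congrFun (congrFun h2 j) i
  rw [Matrix.mul_diagonal] at this
  rw [Pi.smul_apply, smul_eq_mul, mul_comm]
  exact this

/-- Commuting diagonalizable matrices are simultaneously diagonalizable. -/
theorem exists_simultaneous_diagonalization {d : ℕ} {ι : Type*}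
    (T : ι → Matrix (Fin d) (Fin d) ℂ) (hcomm : ∀ i j, Commute (T i) (T j))
    (hT : ∀ i, IsDiagonalizable (T i)) :
    ∃ (Q : Matrix (Fin d) (Fin d) ℂ) (w : ι → Fin d → ℂ),
      IsUnit Q ∧ ∀ i, Q * T i * Q⁻¹ = Matrix.diagonal (w i) := by
  have htop :=
    Module.End.iSup_iInf_maxGenEigenspace_eq_top_of_iSup_maxGenEigenspace_eq_top_of_commute
    (fun i => Matrix.toLin' (T i))
    (fun i j _ => by
      change Matrix.toLin' (T i) * Matrix.toLin' (T j) = Matrix.toLin' (T j) * Matrix.toLin' (T i)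
      rw [Module.End.mul_eq_comp, Module.End.mul_eq_comp, ← Matrix.toLin'_mul, ← Matrix.toLin'_mul,
        (hcomm i j).eq])
    (fun i => (maxGenEigenspace_of_isDiagonalizable (hT i)).2)
  simp only [(maxGenEigenspace_of_isDiagonalizable (hT _)).1] at htop
  let S : Set (Fin d → ℂ) := {v | ∃ χ : ι → ℂ, ∀ i, (T i).mulVec v = χ i • v}
  have hS : ⊤ ≤ Submodule.span ℂ S := by
    rw [← htop, iSup_le_iff]
    intro χ v hv
    refine Submodule.subset_span ⟨χ, fun i => ?_⟩
    have := (Submodule.mem_iInf _).mp hv i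
    rwa [Module.End.mem_eigenspace_iff, Matrix.toLin'_apply] at this
  let b := Module.Basis.ofSpan hS
  have hbS : ∀ x, b x ∈ S := fun x => Module.Basis.ofSpan_subset hS ⟨x, rfl⟩
  let e := b.indexEquiv (Pi.basisFun ℂ (Fin d))
  let b' := b.reindex e
  have hb' : ∀ i, b' i ∈ S := fun i => by rw [Module.Basis.reindex_apply]; exact hbS _
  choose χ hχ using hb'
  let R : Matrix (Fin d) (Fin d) ℂ := (Pi.basisFun ℂ (Fin d)).toMatrix b'
  let Q : Matrix (Fin d) (Fin d) ℂ := b'.toMatrix (Pi.basisFun ℂ (Fin d))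
  have hRQ : R * Q = 1 := Module.Basis.toMatrix_mul_toMatrix_flip _ _
  have hQR : Q * R = 1 := Module.Basis.toMatrix_mul_toMatrix_flip _ _
  have hQ : IsUnit Q := IsUnit.of_mul_eq_one _ hQR
  have hQinv : Q⁻¹ = R := Matrix.inv_eq_right_inv hQR
  refine ⟨Q, fun i j => χ j i, hQ, fun i => ?_⟩
  have hTR : T i * R = R * Matrix.diagonal (fun j => χ j i) := by
    ext l j
    rw [Matrix.mul_diagonal]
    have := congrFun (hχ j i) l
    rw [Pi.smul_apply, smul_eq_mul] at this
    simpa [R, Module.Basis.toMatrix_apply, Matrix.mul_apply, Matrix.mulVec, dotProduct, mul_comm]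
      using this
  rw [hQinv, Matrix.mul_assoc, hTR, ← Matrix.mul_assoc, hQR, Matrix.one_mul]

/-! ### The Kaijser–Varopoulos polynomial is bounded by 5 -/

/-- The polynomial `z₁² + z₂² + z₃² - 2 z₁ z₂ - 2 z₂ z₃ - 2 z₃ z₁` of Kaijser and Varopoulos. -/
noncomputable def kaijserVaropoulos : MvPolynomial (Fin 3) ℂ :=
  .X 0 ^ 2 + .X 1 ^ 2 + .X 2 ^ 2 - 2 * .X 0 * .X 1 - 2 * .X 1 * .X 2 - 2 * .X 2 * .X 0

theorem aeval_kaijserVaropoulos {A : Type*} [CommRing A] [Algebra ℂ A] (a : Fin 3 → A) :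
    MvPolynomial.aeval a kaijserVaropoulos = a 0 ^ 2 + a 1 ^ 2 + a 2 ^ 2 - 2 * a 0 * a 1 -
      2 * a 1 * a 2 - 2 * a 2 * a 0 := by
  simp [kaijserVaropoulos]

/-- Put s = 4 - 4t². For s > 0 the left side is a concave quadratic in c with vertex t(s - 1)/s and
maximum 4(s + 1)²/s, which is at most 25 exactly when 1/4 ≤ s ≤ 4. For s < 1/4 the vertex lies left
of -1, so on [-1, 1] the maximum is at c = -1, with value (4t² + 4t - 3)² ≤ 25; this also covers s =
0. -/
theorem kaijserVaropoulos_real_bound_of_nonneg {t c : ℝ} (ht0 : 0 ≤ t) (ht : t ≤ 1)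
    (hc : c ^ 2 ≤ 1) :
    ((3 - 4 * t ^ 2) * c + 4 * t) ^ 2 + (5 - 4 * t ^ 2) ^ 2 * (1 - c ^ 2) ≤ 25 := by
  obtain ⟨s, hs⟩ : ∃ s, s = 4 - 4 * t ^ 2 := ⟨_, rfl⟩
  have ht2 : 4 * t ^ 2 = 4 - s := by linarith
  have hs4 : s ≤ 4 := by nlinarith
  rw [show 3 - 4 * t ^ 2 = s - 1 by linarith, show 5 - 4 * t ^ 2 = s + 1 by linarith]
  rcases le_or_gt (1 / 4) s with h | h
  · have h1 : s * (((s - 1) * c + 4 * t) ^ 2 + (s + 1) ^ 2 * (1 - c ^ 2)) =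
        4 * s ^ 2 + 8 * s + 4 - (2 * s * c - 2 * t * (s - 1)) ^ 2 := by
      linear_combination (4 * s + (s - 1) ^ 2) * ht2
    have h2 : s * (((s - 1) * c + 4 * t) ^ 2 + (s + 1) ^ 2 * (1 - c ^ 2)) ≤ s * 25 := by
      nlinarith [sq_nonneg (2 * s * c - 2 * t * (s - 1))]
    exact le_of_mul_le_mul_left h2 (by linarith)
  · have hc' := abs_le.mp ((sq_le_one_iff_abs_le_one c).mp hc)
    have hs0 : 0 ≤ s := by nlinarith
    have ht9 : 9 / 10 ≤ t := by nlinarith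
    have h1 : 0 ≤ (1 + c) * (8 * (1 - s) * t - 4 * s * (1 - c)) := by
      apply mul_nonneg (by linarith)
      nlinarith
    have h2 : ((s - 1) * c + 4 * t) ^ 2 + (s + 1) ^ 2 * (1 - c ^ 2) ≤ (1 - s + 4 * t) ^ 2 := by
      nlinarith
    refine h2.trans ?_
    have h3 : 1 - s + 4 * t ≤ 5 := by nlinarith
    have h4 : 0 ≤ 1 - s + 4 * t := by linarith
    nlinarith

theorem kaijserVaropoulos_real_bound {t c : ℝ} (ht : t ^ 2 ≤ 1) (hc : c ^ 2 ≤ 1) :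
    ((3 - 4 * t ^ 2) * c + 4 * t) ^ 2 + (5 - 4 * t ^ 2) ^ 2 * (1 - c ^ 2) ≤ 25 := by
  have ht' := abs_le.mp ((sq_le_one_iff_abs_le_one t).mp ht)
  rcases le_total 0 t with h | h
  · exact kaijserVaropoulos_real_bound_of_nonneg h ht'.2 hc
  · have := kaijserVaropoulos_real_bound_of_nonneg (t := -t) (c := -c) (by linarith)
      (by linarith) (by simpa using hc)
    nlinarith

/-- With square roots a, b of x, y, dividing by the unimodular number abz leaves an expression in
two unimodular numbers q and w. Its squared modulus is the left side of
`kaijserVaropoulos_real_bound` at t = Re q, c = Re w. -/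
theorem kaijserVaropoulos_bound_torus {x y z : ℂ} (hx : ‖x‖ = 1) (hy : ‖y‖ = 1) (hz : ‖z‖ = 1) :
    ‖x ^ 2 + y ^ 2 + z ^ 2 - 2 * x * y - 2 * y * z - 2 * z * x‖ ≤ 5 := by
  have hconj : ∀ {w : ℂ}, ‖w‖ = 1 → w * starRingEnd ℂ w = 1 := fun {w} hw => by
    rw [Complex.mul_conj, Complex.normSq_eq_norm_sq, hw]; simp
  have hsq : ∀ {w : ℂ}, ‖w‖ = 1 → w.re ^ 2 + w.im ^ 2 = 1 := fun {w} hw => by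
    have := Complex.sq_norm w
    rw [hw, Complex.normSq_apply] at this
    linarith
  have hroot : ∀ {w : ℂ}, ‖w‖ = 1 → ∃ a : ℂ, ‖a‖ = 1 ∧ a ^ 2 = w := fun {w} hw => by
    obtain ⟨a, ha⟩ := IsAlgClosed.exists_pow_nat_eq w two_pos
    refine ⟨a, ?_, ha⟩
    rw [← ha, norm_pow] at hw
    exact (pow_eq_one_iff_of_nonneg (norm_nonneg a) two_ne_zero).mp hw
  obtain ⟨a, ha, rfl⟩ := hroot hx
  obtain ⟨b, hb, rfl⟩ := hroot hy
  let q := a * starRingEnd ℂ b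
  let w := a * b * starRingEnd ℂ z
  have hq : q.re ^ 2 + q.im ^ 2 = 1 := hsq (by simp [q, ha, hb])
  have hw : w.re ^ 2 + w.im ^ 2 = 1 := hsq (by simp [w, ha, hb, hz])
  have key : (a ^ 2) ^ 2 + (b ^ 2) ^ 2 + z ^ 2 - 2 * a ^ 2 * b ^ 2 - 2 * b ^ 2 * z - 2 * z * a ^ 2 =
      a * b * z * ((q - starRingEnd ℂ q) ^ 2 * w + starRingEnd ℂ w
        - 2 * (q + starRingEnd ℂ q)) := by
    have h1 := hconj ha
    have h2 := hconj hb
    have h3 := hconj hz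
    simp only [q, w, map_mul, Complex.conj_conj]
    generalize starRingEnd ℂ a = a' at *
    generalize starRingEnd ℂ b = b' at *
    generalize starRingEnd ℂ z = z' at *
    have e1 : a * b * z * ((a * b' - a' * b) ^ 2 * (a * b * z') + a' * b' * z -
        2 * (a * b' + a' * b)) = (z * z') * (a ^ 2 * (b * b') - (a * a') * b ^ 2) ^ 2 +
          (a * a') * (b * b') * z ^ 2 - 2 * (a ^ 2 * (b * b') * z + (a * a') * b ^ 2 * z) := by
      ring
    rw [e1, h1, h2, h3]
    ring
  have hre : (q - starRingEnd ℂ q) ^ 2 = ((4 * q.re ^ 2 - 4 : ℝ) : ℂ) := by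
    rw [Complex.sub_conj, mul_pow, Complex.I_sq]
    have : q.im ^ 2 = 1 - q.re ^ 2 := by linarith
    rw [← Complex.ofReal_pow, mul_pow, this]
    push_cast
    ring
  have hre2 : q + starRingEnd ℂ q = ((2 * q.re : ℝ) : ℂ) := Complex.add_conj q
  rw [key, norm_mul, norm_mul, norm_mul, ha, hb, hz, one_mul, one_mul, one_mul, hre, hre2]
  refine abs_le_of_sq_le_sq' ?_ (by norm_num) |>.2
  rw [Complex.sq_norm, Complex.normSq_apply]
  have := kaijserVaropoulos_real_bound (t := q.re) (c := w.re) (by nlinarith) (by nlinarith)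
  simp only [Complex.add_re, Complex.sub_re, Complex.mul_re, Complex.ofReal_re, Complex.ofReal_im,
    Complex.conj_re, Complex.add_im, Complex.sub_im, Complex.mul_im, Complex.conj_im,
    Complex.re_ofNat, Complex.im_ofNat]
  have him : w.im ^ 2 = 1 - w.re ^ 2 := by linarith
  rw [← him] at this
  nlinarith

theorem norm_le_of_sphere {f : ℂ → ℂ} (hf : Differentiable ℂ f) {C : ℝ}
    (h : ∀ z, ‖z‖ = 1 → ‖f z‖ ≤ C) {z : ℂ} (hz : ‖z‖ ≤ 1) : ‖f z‖ ≤ C := by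
  refine Complex.norm_le_of_forall_mem_frontier_norm_le (U := Metric.ball 0 1)
    Metric.isBounded_ball hf.diffContOnCl (fun w hw => ?_) ?_
  · rw [frontier_ball _ one_ne_zero, mem_sphere_zero_iff_norm] at hw
    exact h w hw
  · rwa [closure_ball _ one_ne_zero, mem_closedBall_zero_iff]

theorem polydiskNorm_kaijserVaropoulos_le : polydiskNorm kaijserVaropoulos ≤ 5 := by
  refine polydiskNorm_le _ fun z hz => ?_
  rw [← MvPolynomial.coe_aeval_eq_eval, RingHom.coe_coe, aeval_kaijserVaropoulos]
  refine norm_le_of_sphere (f := fun x => x ^ 2 + z 1 ^ 2 + z 2 ^ 2 - 2 * x * z 1 -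
    2 * z 1 * z 2 - 2 * z 2 * x) (by fun_prop) (fun x hx => ?_) (hz 0)
  refine norm_le_of_sphere (f := fun y => x ^ 2 + y ^ 2 + z 2 ^ 2 - 2 * x * y -
    2 * y * z 2 - 2 * z 2 * x) (by fun_prop) (fun y hy => ?_) (hz 1)
  exact norm_le_of_sphere (f := fun w => x ^ 2 + y ^ 2 + w ^ 2 - 2 * x * y -
    2 * y * w - 2 * w * x) (by fun_prop) (fun w hw => kaijserVaropoulos_bound_torus hx hy hw) (hz 2)

/-! ### Contractions on the deformed nilpotent algebra -/

/-- The first coordinates of four points in the plane. -/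
noncomputable def pointX : Fin 4 → ℂ := ![1 / 10, -1 / 10, 0, 0]

/-- The second coordinates of four points in the plane. -/
noncomputable def pointY : Fin 4 → ℂ := ![0, 0, Complex.I / 10, -Complex.I / 10]

theorem pointX_mul_pointY (i : Fin 4) : pointX i * pointY i = 0 := by
  fin_cases i <;> simp [pointX, pointY]

theorem pointX_sq_sub_pointY_sq (i : Fin 4) : pointY i ^ 2 = pointX i ^ 2 - 1 / 100 := by
  fin_cases i <;> simp [pointX, pointY, div_pow] <;> norm_num

/-- Evaluation of `1, x, y, x²` at the four points. -/
noncomputable def evaluationMatrix : Matrix (Fin 4) (Fin 4) ℂ :=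
  Matrix.of fun i => ![1, pointX i, pointY i, pointX i ^ 2]

theorem isUnit_evaluationMatrix : IsUnit evaluationMatrix := by
  refine IsUnit.of_mul_eq_one
    !![0, 0, 1 / 2, 1 / 2; 5, -5, 0, 0; 0, 0, -5 * Complex.I, 5 * Complex.I;
      50, 50, -50, -50] ?_
  ext i j
  fin_cases i <;> fin_cases j <;>
    simp [evaluationMatrix, pointX, pointY, Matrix.mul_apply, Fin.sum_univ_four] <;>
    ring_nf <;> norm_num [Complex.I_sq]

/-- Multiplication by `99/100 (u x + v y)` in the basis `1, x, y, x²` of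
`ℂ[x, y] / (x y, x² - y² - 1/100)`. -/
noncomputable def multiplicationMatrix (u v : ℝ) : Matrix (Fin 4) (Fin 4) ℂ :=
  (99 / 100 : ℂ) • (!![0, 0, -(v : ℂ) / 100, 0; (u : ℂ), 0, 0, (u : ℂ) / 100; (v : ℂ), 0, 0, 0;
    0, (u : ℂ), (v : ℂ), 0] : Matrix (Fin 4) (Fin 4) ℂ)

/-- Since (u, v) is a unit vector, the terms without 1/100 form a contraction; the remaining ones
fit into the slack (100/99)² - 1 > 1/50. -/
theorem multiplication_real_bound {u v : ℝ} (huv : u ^ 2 + v ^ 2 = 1) (a b d e : ℝ) :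
    (v / 100 * d) ^ 2 + (u * a + u / 100 * e) ^ 2 + (v * a) ^ 2 + (u * b + v * d) ^ 2 ≤
      (100 / 99) ^ 2 * (a ^ 2 + b ^ 2 + d ^ 2 + e ^ 2) := by
  have h1 : (u * b + v * d) ^ 2 ≤ b ^ 2 + d ^ 2 := by
    have : (u * b + v * d) ^ 2 = (u ^ 2 + v ^ 2) * (b ^ 2 + d ^ 2) - (u * d - v * b) ^ 2 := by ring
    rw [this, huv]
    nlinarith [sq_nonneg (u * d - v * b)]
  have hv : v ^ 2 ≤ 1 := by nlinarith
  have hu : u ^ 2 ≤ 1 := by nlinarith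
  have h2 : (v / 100 * d) ^ 2 ≤ d ^ 2 / 10000 := by
    nlinarith [mul_le_mul_of_nonneg_right hv (sq_nonneg d)]
  have h3 : (u * a + u / 100 * e) ^ 2 ≤ u ^ 2 * a ^ 2 + (a ^ 2 / 100 + e ^ 2 / 50) := by
    have : (u * a + u / 100 * e) ^ 2 =
        u ^ 2 * a ^ 2 + u ^ 2 * (a * e / 50 + e ^ 2 / 10000) := by ring
    have h5 : a * e / 50 + e ^ 2 / 10000 ≤ a ^ 2 / 100 + e ^ 2 / 50 := by
      nlinarith [sq_nonneg (a - e), sq_nonneg e]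
    have h6 : 0 ≤ a ^ 2 / 100 + e ^ 2 / 50 := by positivity
    rw [this]
    nlinarith [mul_le_mul_of_nonneg_left h5 (sq_nonneg u)]
  have h4 : u ^ 2 * a ^ 2 + (v * a) ^ 2 = a ^ 2 := by
    rw [mul_pow, ← add_mul, huv, one_mul]
  nlinarith [sq_nonneg a, sq_nonneg b, sq_nonneg d, sq_nonneg e]

theorem norm_multiplicationMatrix_le {u v : ℝ} (huv : u ^ 2 + v ^ 2 = 1) :
    ‖multiplicationMatrix u v‖ ≤ 1 := by
  rw [← Matrix.l2_opNorm_toEuclideanCLM]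
  refine ContinuousLinearMap.opNorm_le_bound _ zero_le_one fun x => ?_
  rw [one_mul, ← sq_le_sq₀ (norm_nonneg _) (norm_nonneg _), EuclideanSpace.norm_sq_eq,
    EuclideanSpace.norm_sq_eq, Fin.sum_univ_four, Fin.sum_univ_four]
  simp only [Matrix.ofLp_toEuclideanCLM]
  have hre := multiplication_real_bound huv (x 0).re (x 1).re (x 2).re (x 3).re
  have him := multiplication_real_bound huv (x 0).im (x 1).im (x 2).im (x 3).im
  simp only [Complex.sq_norm, Complex.normSq_apply]
  simp [multiplicationMatrix, Matrix.mulVec, dotProduct, Fin.sum_univ_four]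
  linear_combination (99 / 100) ^ 2 * hre + (99 / 100) ^ 2 * him

/-- Evaluation at the four points turns multiplication in the quotient algebra into pointwise
multiplication, so one matrix diagonalizes every `multiplicationMatrix u v`. The identities use xy =
0, y² = x² - 1/100 and their consequence x³ = x/100. -/
theorem conjDiagonal_evaluationMatrix (u v : ℝ) :
    conjDiagonal evaluationMatrix isUnit_evaluationMatrix
      (fun i => 99 / 100 * (u * pointX i + v * pointY i)) = multiplicationMatrix u v := by
  have hQ := isUnit_evaluationMatrix
  symm
  apply eq_conjDiagonal hQ
  have h : evaluationMatrix * multiplicationMatrix u v =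
      Matrix.diagonal (fun i => 99 / 100 * (u * pointX i + v * pointY i)) * evaluationMatrix := by
    ext i j
    have h1 := pointX_mul_pointY i
    have h2 := pointX_sq_sub_pointY_sq i
    have h3 : pointX i ^ 3 = pointX i / 100 := by
      linear_combination -pointX i * h2 + pointY i * h1
    rw [Matrix.diagonal_mul]
    fin_cases j <;>
      simp [evaluationMatrix, multiplicationMatrix, Matrix.mul_apply, Fin.sum_univ_four]
    · ring
    · linear_combination (-99 / 100 * v) * h1
    · linear_combination (-99 / 100 * u) * h1 - 99 / 100 * v * h2
    · linear_combination (-99 / 100 * u) * h3 - 99 / 100 * v * pointX i * h1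
  rw [h, Matrix.mul_assoc, Matrix.mul_nonsing_inv _ ((Matrix.isUnit_iff_isUnit_det _).mp hQ),
    Matrix.mul_one]

theorem exists_violatesVonNeumann :
    ∃ (T : Fin 3 → Matrix (Fin 4) (Fin 4) ℂ) (p : MvPolynomial (Fin 3) ℂ),
      ViolatesVonNeumann T p := by
  have hQ := isUnit_evaluationMatrix
  -- Rational unit vectors (1, 0), (-3/5, ±4/5), close to 120° apart.
  let u : Fin 3 → ℝ := ![1, -3 / 5, -3 / 5]
  let v : Fin 3 → ℝ := ![0, 4 / 5, -4 / 5]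
  let w : Fin 3 → Fin 4 → ℂ := fun j i => 99 / 100 * (u j * pointX i + v j * pointY i)
  let c := conjDiagonal evaluationMatrix hQ
  refine ⟨fun j => c (w j), kaijserVaropoulos, ⟨fun i j => ?_, fun j => ?_, fun j => ?_, ?_⟩⟩
  · exact (Commute.all (w i) (w j)).map c
  · exact ⟨_, hQ, w j, mul_conjDiagonal_mul_inv hQ _⟩
  · rw [show c (w j) = multiplicationMatrix (u j) (v j) from conjDiagonal_evaluationMatrix _ _]
    apply norm_multiplicationMatrix_le
    fin_cases j <;> norm_num [u, v]
  · rw [evalCommuting_map]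
    refine polydiskNorm_kaijserVaropoulos_le.trans_lt ?_
    let g : Fin 4 → ℂ := MvPolynomial.aeval w kaijserVaropoulos
    -- Coordinates of the value in the basis 1, x, y, x². Here 596/100 = 3 - 2(-3/5 - 3/5 - 7/25)
    -- comes from the inner products, and the constant term from y² = x² - 1/100.
    let κ : Fin 4 → ℂ := ![-(99 / 100) ^ 2 * 256 / 10000, 0, 0, (99 / 100) ^ 2 * 596 / 100]
    have hg : evaluationMatrix.mulVec κ = g := by
      ext i
      have h1 := pointX_mul_pointY i
      have h2 := pointX_sq_sub_pointY_sq i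
      simp only [g, aeval_kaijserVaropoulos]
      simp [evaluationMatrix, Matrix.mulVec, dotProduct, Fin.sum_univ_four, κ, w, u, v]
      linear_combination (-(99 / 100) ^ 2 * 256 / 100) * h2
    have hone : evaluationMatrix.mulVec (Pi.single 0 1) = 1 := by
      ext i
      simp [evaluationMatrix]
    have hκ : (c g).mulVec (Pi.single 0 1) = κ := by
      rw [show c g = _ from conjDiagonal_apply hQ g, Matrix.mul_assoc, ← Matrix.mulVec_mulVec,
        ← Matrix.mulVec_mulVec, hone]
      have : (Matrix.diagonal g).mulVec 1 = g := by
        ext i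
        rw [Matrix.mulVec_diagonal, Pi.one_apply, mul_one]
      rw [this, ← hg, Matrix.mulVec_mulVec,
        Matrix.nonsing_inv_mul _ ((Matrix.isUnit_iff_isUnit_det _).mp hQ), Matrix.one_mulVec]
    -- Applied to the basis vector 1, the operator gives κ, whose last entry, about 5.84, already
    -- exceeds 5.
    have h1 := Matrix.l2_opNorm_mulVec (c g) (EuclideanSpace.single 0 1)
    rw [PiLp.norm_single, norm_one, mul_one] at h1
    have h2 : ‖κ 3‖ ≤ ‖c g‖ := by
      refine le_trans ?_ h1
      have h3 := PiLp.norm_apply_le (p := 2) (WithLp.toLp 2 κ) 3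
      rw [← hκ] at h3 ⊢
      exact h3
    refine lt_of_lt_of_le ?_ h2
    rw [show κ 3 = ((99 / 100) ^ 2 * 596 / 100 : ℝ) by simp [κ], Complex.norm_real]
    norm_num

/-! ### Consequences of a violation and the main theorem -/

namespace ViolatesVonNeumann

variable {T : Fin 3 → Matrix (Fin 4) (Fin 4) ℂ} {p : MvPolynomial (Fin 3) ℂ}
  {Q : Matrix (Fin 4) (Fin 4) ℂ} {w : Fin 3 → Fin 4 → ℂ}

theorem norm_conjRepresentation_le (h : ViolatesVonNeumann T p) (hQ : IsUnit Q)
    (hw : ∀ j, Q * T j * Q⁻¹ = Matrix.diagonal (w j)) (j : Fin 3) :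
    ‖conjRepresentation Q hQ (w j)‖ ≤ 1 := by
  rw [norm_conjRepresentation, ← eq_conjDiagonal hQ (hw j)]
  exact h.contraction j

theorem lt_norm_conjRepresentation (h : ViolatesVonNeumann T p) (hQ : IsUnit Q)
    (hw : ∀ j, Q * T j * Q⁻¹ = Matrix.diagonal (w j)) :
    polydiskNorm p < ‖conjRepresentation Q hQ (MvPolynomial.aeval w p)‖ := by
  rw [norm_conjRepresentation, ← evalCommuting_map,
    ← show T = fun j => conjDiagonal Q hQ (w j) from funext fun j => eq_conjDiagonal hQ (hw j)]
  exact h.lt_norm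

theorem polydiskNorm_pos (h : ViolatesVonNeumann T p) : 0 < polydiskNorm p := by
  refine (polydiskNorm_nonneg p).lt_of_ne fun h0 => ?_
  have hp := eq_zero_of_polydiskNorm_eq_zero h0.symm
  have := h.lt_norm
  rw [← h0, hp] at this
  simp [evalCommuting] at this

theorem inv_smul_notMem_ball (h : ViolatesVonNeumann T p) (hQ : IsUnit Q)
    (hw : ∀ j, Q * T j * Q⁻¹ = Matrix.diagonal (w j)) :
    ¬ ‖conjRepresentation Q hQ ((polydiskNorm p : ℂ)⁻¹ • MvPolynomial.aeval w p)‖ ≤ 1 := by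
  rw [map_smul, norm_smul, norm_inv, Complex.norm_real, Real.norm_of_nonneg h.polydiskNorm_pos.le,
    inv_mul_le_iff₀ h.polydiskNorm_pos, mul_one, not_le]
  exact h.lt_norm_conjRepresentation hQ hw

end ViolatesVonNeumann

theorem hyperconvexBalls_ssubset_operatorAlgebraBalls {k : ℕ} (hk : 4 ≤ k) :
    hyperconvexBalls k ⊂ operatorAlgebraBalls k := by
  obtain ⟨T, p, h⟩ := exists_violatesVonNeumann
  obtain ⟨Q, w, hQ, hw⟩ := exists_simultaneous_diagonalization T h.commute h.diagonalizable
  obtain ⟨B, hB, hB'⟩ := exists_operatorAlgebraBall_not_isHyperconvex hk (by omega)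
    (conjRepresentation Q hQ) (conjRepresentation_injective hQ) w
    (h.norm_conjRepresentation_le hQ hw) p (h.lt_norm_conjRepresentation hQ hw)
  exact ⟨hyperconvexBalls_subset_operatorAlgebraBalls k, fun hsub => hB' (hsub hB)⟩

theorem mainTheorem3 :
    -- There are three commuting diagonalizable contractions violating von Neumann's inequality.
    (∃ (T : Fin 3 → Matrix (Fin 4) (Fin 4) ℂ) (p : MvPolynomial (Fin 3) ℂ),
      ViolatesVonNeumann T p) ∧
    -- Any such triple gives a 4-idempotent operator algebra whose ball is not hyperconvex.
    (∀ (T : Fin 3 → Matrix (Fin 4) (Fin 4) ℂ) (p : MvPolynomial (Fin 3) ℂ),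
      ViolatesVonNeumann T p →
        (∃ (Q : Matrix (Fin 4) (Fin 4) ℂ) (w : Fin 3 → Fin 4 → ℂ),
          IsUnit Q ∧ ∀ j, Q * T j * Q⁻¹ = Matrix.diagonal (w j)) ∧
        ∀ (Q : Matrix (Fin 4) (Fin 4) ℂ) (w : Fin 3 → Fin 4 → ℂ),
          IsUnit Q → (∀ j, Q * T j * Q⁻¹ = Matrix.diagonal (w j)) →
            IsIdempotentSystem (conjIdempotent Q) ∧
            (∃ A : Subalgebra ℂ (EuclideanSpace ℂ (Fin 4) →L[ℂ] EuclideanSpace ℂ (Fin 4)),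
              Subalgebra.toSubmodule A = Submodule.span ℂ (Set.range (conjIdempotent Q)) ∧
              IsIdempotentOperatorAlgebra 4 A) ∧
            idempotentBall (conjIdempotent Q) ∈ operatorAlgebraBalls 4 ∧
            (∀ j, w j ∈ idempotentBall (conjIdempotent Q)) ∧
            ((polydiskNorm p : ℂ)⁻¹ • MvPolynomial.aeval w p) ∉
              idempotentBall (conjIdempotent Q) ∧
            ¬ IsHyperconvex (idempotentBall (conjIdempotent Q))) ∧
    -- Consequently the two classes differ for `k = 4`, and the inclusion is proper for `k ≥ 4`.
    hyperconvexBalls 4 ≠ operatorAlgebraBalls 4 ∧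
    ∀ k : ℕ, 4 ≤ k → hyperconvexBalls k ⊂ operatorAlgebraBalls k := by
  refine ⟨exists_violatesVonNeumann, fun T p h => ⟨?_, fun Q w hQ hw => ?_⟩,
    (hyperconvexBalls_ssubset_operatorAlgebraBalls le_rfl).ne,
    fun k hk => hyperconvexBalls_ssubset_operatorAlgebraBalls hk⟩
  · exact exists_simultaneous_diagonalization T h.commute h.diagonalizable
  · have hle := h.norm_conjRepresentation_le hQ hw
    rw [idempotentBall_conjIdempotent hQ]
    exact ⟨isIdempotentSystem_conjIdempotent hQ, exists_subalgebra_span_conjIdempotent hQ,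
      ball_mem_operatorAlgebraBalls (by norm_num) _ (conjRepresentation_injective hQ), hle,
      h.inv_smul_notMem_ball hQ hw,
      not_isHyperconvex_ball _ w hle p (h.lt_norm_conjRepresentation hQ hw)⟩
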